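/- **Setting.** A graphon is a measurable symmetric function $f:[0,1]^2\to[0,1]$. For graphons $f,g$ put $d_\square(f,g)=\sup_{S,T}\bigl|\int_{S\times T}(f-g)\bigr|$ ($S,T\subseteq[0,1]$ measurable) and $\delta_\square(f,g)=\inf_{\varphi} d_\square(f,g^{\varphi})$, where $g^\varphi(x,y)=g(\varphi(x),\varphi(y))$ and $\varphi$ runs over the invertible Lebesgue measure-preserving maps of $[0,1]$. Let $\widetilde{\mathcal W}$ be the space of classes $\tilde f$ of graphons modulo $\delta_\square=0$, with the metric $\delta_\square$. For $p,u\in[0,1]$ let $h_p(u)=u\log\frac up+(1-u)\log\frac{1-u}{1-p}\in[0,\infty]$ (with $0\log 0=0\log\frac00=0$). For a graphon $W_0$ let $I_{W_0}(f)=\frac12\int_{[0,1]^2}h_{W_0(x,y)}(f(x,y))\,dx\,dy$, let $\mathcal W_\Omega$ be the set of graphons equal to $W_0$ almost everywhere on $\{W_0\in\{0,1\}\}$, let $\widetilde{\mathcal W}_\Omega$ be the set of their classes, and let $$J_{W_0}(\tilde f)=\sup_{\eta>0}\ \inf\{I_{W_0}(h): h \text{ a graphon},\ \delta_\square(\tilde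 f,h)\le\eta\}\ \text{ if }\tilde f\in\widetilde{\mathcal W}_\Omega,\qquad J_{W_0}(\tilde f)=\infty\ \text{ otherwise.}$$ The operator norm $\|f\|_{\rm op}$ of a graphon is the norm of $u\mapsto\int_0^1 f(\cdot,y)u(y)\,dy$ on $L^2([0,1])$; it depends only on $\tilde f$. For $0<\gamma<1$ let $\mathcal B^{(\gamma,1-\gamma)}$ be the set of graphons that are constant on each of $[0,\gamma]^2$, $(\gamma,1]^2$ and $([0,\gamma]\times(\gamma,1])\cup((\gamma,1]\times[0,\gamma])$, and for $q\in[0,1]$ let $f_q^\gamma\in\mathcal B^{(\gamma,1-\gamma)}$ be the graphon with the values $0$, $0$, $q$ on these three sets. For $W_0=f_p^\gamma$ and a real number $t\le t_{\max}:=\sup\{\|\tilde f\|_{\rm op}:\tilde f\in\widetilde{\mathcal W}_\Omega\}$, we say that $t$ is in the symmetric regime (for $W_0$ and $\|\cdot\|_{\rm op}$) if every minimizer of $$\min\{J_{W_0}(\tilde f):\tilde f\in\widetilde{\mathcal W},\ \|\tilde f\|_{\rm op}\ge t\}\qquad(*)$$ is the class of a graphon in $\mathcal B^{(\gamma,1-\gamma)}$.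 **Theorem.** Let $0<p<1$, $0<\gamma<1$, $W_0=f_p^\gamma$, $r\in[p,1]$ and $t_r^\gamma=\|f_r^\gamma\|_{\rm op}$. Then $t_r^\gamma\le t_{\max}$, and: 1. If $(r^2,h_p(r))$ lies on the convex minorant of the function $x\mapsto h_p(\sqrt x)$ on $[0,1]$, then $t_r^\gamma$ is in the symmetric regime, and $\tilde f_r^\gamma$ is the unique minimizer of $(*)$ with $t=t_r^\gamma$. 2. If $(r^2,h_p(r))$ does not lie on the convex minorant of $x\mapsto h_p(\sqrt x)$ on $[0,1]$, then $t_r^\gamma$ is not in the symmetric regime. -/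

import Mathlib

open MeasureTheory unitInterval
open scoped ENNReal

noncomputable section

/-! ### Graphons and the cut metric -/

/-- A graphon: a measurable symmetric function `[0,1]² → [0,1]`. -/
structure Graphon where
  toFun : I → I → ℝ
  measurable' : Measurable (Function.uncurry toFun)
  mem_Icc' : ∀ x y, toFun x y ∈ Set.Icc (0 : ℝ) 1
  symm' : ∀ x y, toFun x y = toFun y x

namespace Graphon

instance : CoeFun Graphon (fun _ => I → I → ℝ) := ⟨Graphon.toFun⟩

/-- The set `ℳ` of invertible, Lebesgue measure-preserving maps of `[0,1]`. -/
abbrev Rearrangement : Type := {φ : I ≃ᵐ I // MeasurePreserving φ volume volume}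

/-- The rearranged graphon `f^φ(x,y) = f(φ x, φ y)`. -/
def rearrange (f : Graphon) (φ : Rearrangement) : Graphon where
  toFun x y := f (φ.1 x) (φ.1 y)
  measurable' := f.measurable'.comp (φ.1.measurable.prodMap φ.1.measurable)
  mem_Icc' _ _ := f.mem_Icc' _ _
  symm' _ _ := f.symm' _ _

/-- The measurable subsets of `[0,1]`. -/
abbrev MSet : Type := {S : Set I // MeasurableSet S}

/-- The integral of `f - g` over `S × T`. -/
def rectDiff (f g : Graphon) (S T : Set I) : ℝ :=
  ∫ z in S ×ˢ T, (f z.1 z.2 - g z.1 z.2)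

/-- The cut distance `d_□(f,g) = sup_{S,T} |∫_{S×T} (f - g)|`. -/
def cutDist (f g : Graphon) : ℝ :=
  ⨆ ST : MSet × MSet, |rectDiff f g ST.1 ST.2|

/-- The cut metric `δ_□(f,g) = inf_φ d_□(f, g^φ)`. -/
def cutMetric (f g : Graphon) : ℝ :=
  ⨅ φ : Rearrangement, cutDist f (g.rearrange φ)

lemma integrable_diff (f g : Graphon) :
    Integrable (fun z : I × I => f z.1 z.2 - g z.1 z.2) := by
  refine Integrable.of_bound (C := 1) (f.measurable'.sub g.measurable').aestronglyMeasurable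
    (ae_of_all _ fun z => ?_)
  have h1 := f.mem_Icc' z.1 z.2
  have h2 := g.mem_Icc' z.1 z.2
  rw [Real.norm_eq_abs, abs_le]
  constructor <;> linarith [h1.1, h1.2, h2.1, h2.2]

lemma abs_rectDiff_le_one (f g : Graphon) (S T : Set I) : |rectDiff f g S T| ≤ 1 := by
  have h : ‖∫ z in S ×ˢ T, (f z.1 z.2 - g z.1 z.2)‖ ≤ 1 * (volume : Measure (I × I)).real (S ×ˢ T) := by
    refine norm_setIntegral_le_of_norm_le_const (measure_lt_top _ _) (fun z _ => ?_)
    have h1 := f.mem_Icc' z.1 z.2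
    have h2 := g.mem_Icc' z.1 z.2
    rw [Real.norm_eq_abs, abs_le]
    constructor <;> linarith [h1.1, h1.2, h2.1, h2.2]
  have h3 : (volume : Measure (I × I)).real (S ×ˢ T) ≤ 1 := measureReal_le_one
  unfold rectDiff
  rw [← Real.norm_eq_abs]
  linarith

lemma bddAbove_rectDiff (f g : Graphon) :
    BddAbove (Set.range fun ST : MSet × MSet => |rectDiff f g ST.1 ST.2|) :=
  ⟨1, by rintro _ ⟨ST, rfl⟩; exact abs_rectDiff_le_one f g _ _⟩

instance : Nonempty MSet := ⟨⟨∅, MeasurableSet.empty⟩⟩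

instance : Nonempty Rearrangement := ⟨⟨MeasurableEquiv.refl I, MeasurePreserving.id _⟩⟩

lemma le_cutDist (f g : Graphon) {S T : Set I} (hS : MeasurableSet S) (hT : MeasurableSet T) :
    |rectDiff f g S T| ≤ cutDist f g :=
  le_ciSup (bddAbove_rectDiff f g) ((⟨S, hS⟩, ⟨T, hT⟩) : MSet × MSet)

lemma cutDist_nonneg (f g : Graphon) : 0 ≤ cutDist f g :=
  Real.iSup_nonneg fun _ => abs_nonneg _

lemma cutDist_self (f : Graphon) : cutDist f f = 0 := by
  simp [cutDist, rectDiff]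

lemma cutDist_comm (f g : Graphon) : cutDist f g = cutDist g f := by
  unfold cutDist
  congr 1
  ext ST
  rw [← abs_neg]
  congr 1
  unfold rectDiff
  rw [← integral_neg]
  simp

lemma cutDist_triangle (f g h : Graphon) : cutDist f h ≤ cutDist f g + cutDist g h := by
  refine ciSup_le fun ST => ?_
  have : rectDiff f h ST.1 ST.2 = rectDiff f g ST.1 ST.2 + rectDiff g h ST.1 ST.2 := by
    unfold rectDiff
    rw [← integral_add (integrable_diff f g).integrableOn (integrable_diff g h).integrableOn]
    simp
  rw [this]
  exact (abs_add_le _ _).trans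
    (add_le_add (le_cutDist f g ST.1.2 ST.2.2) (le_cutDist g h ST.1.2 ST.2.2))

/-- Inverse of a rearrangement. -/
def Rearrangement.inv (φ : Rearrangement) : Rearrangement := ⟨φ.1.symm, φ.2.symm⟩

/-- Composition: first `φ`, then `ψ`. -/
def Rearrangement.comp (φ ψ : Rearrangement) : Rearrangement :=
  ⟨φ.1.trans ψ.1, ψ.2.comp φ.2⟩

lemma rectDiff_rearrange (f g : Graphon) (φ : Rearrangement) (S T : Set I) :
    rectDiff (f.rearrange φ) (g.rearrange φ) (φ.1 ⁻¹' S) (φ.1 ⁻¹' T) = rectDiff f g S T := by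
  have hp : MeasurePreserving (φ.1.prodCongr φ.1) (volume : Measure (I × I)) volume :=
    φ.2.prod φ.2
  exact hp.setIntegral_preimage_emb (φ.1.prodCongr φ.1).measurableEmbedding
    (fun z : I × I => f z.1 z.2 - g z.1 z.2) (S ×ˢ T)

lemma cutDist_rearrange_ge (f g : Graphon) (φ : Rearrangement) :
    cutDist f g ≤ cutDist (f.rearrange φ) (g.rearrange φ) := by
  refine ciSup_le fun ST => ?_
  rw [← rectDiff_rearrange f g φ]
  exact le_cutDist _ _ (φ.1.measurable ST.1.2) (φ.1.measurable ST.2.2)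

lemma rearrange_comp (f : Graphon) (φ ψ : Rearrangement) :
    (f.rearrange ψ).rearrange φ = f.rearrange (φ.comp ψ) := rfl

lemma rearrange_inv (f : Graphon) (φ : Rearrangement) :
    (f.rearrange φ).rearrange φ.inv = f := by
  cases f
  simp [rearrange, Rearrangement.inv]

lemma cutDist_rearrange (f g : Graphon) (φ : Rearrangement) :
    cutDist (f.rearrange φ) (g.rearrange φ) = cutDist f g := by
  refine le_antisymm ?_ (cutDist_rearrange_ge f g φ)
  have := cutDist_rearrange_ge (f.rearrange φ) (g.rearrange φ) φ.inv
  rwa [rearrange_inv, rearrange_inv] at this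

lemma bddBelow_cutDist (f g : Graphon) :
    BddBelow (Set.range fun φ : Rearrangement => cutDist f (g.rearrange φ)) :=
  ⟨0, by rintro _ ⟨φ, rfl⟩; exact cutDist_nonneg _ _⟩

lemma cutMetric_le (f g : Graphon) (φ : Rearrangement) :
    cutMetric f g ≤ cutDist f (g.rearrange φ) :=
  ciInf_le (bddBelow_cutDist f g) φ

lemma cutMetric_self (f : Graphon) : cutMetric f f = 0 := by
  refine le_antisymm ?_ (Real.iInf_nonneg fun _ => cutDist_nonneg _ _)
  have := cutMetric_le f f ⟨MeasurableEquiv.refl I, MeasurePreserving.id _⟩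
  exact this.trans (cutDist_self f).le

lemma cutMetric_comm_le (f g : Graphon) : cutMetric f g ≤ cutMetric g f := by
  refine le_ciInf fun φ => ?_
  calc cutMetric f g ≤ cutDist f (g.rearrange φ.inv) := cutMetric_le _ _ _
    _ = cutDist ((f.rearrange φ).rearrange φ.inv) (g.rearrange φ.inv) := by rw [rearrange_inv]
    _ = cutDist g (f.rearrange φ) := by rw [cutDist_rearrange, cutDist_comm]

lemma cutMetric_triangle (f g h : Graphon) : cutMetric f h ≤ cutMetric f g + cutMetric g h := by
  refine le_ciInf_add_ciInf fun φ ψ => ?_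
  calc cutMetric f h ≤ cutDist f (h.rearrange (φ.comp ψ)) := cutMetric_le _ _ _
    _ ≤ cutDist f (g.rearrange φ) + cutDist (g.rearrange φ) ((h.rearrange ψ).rearrange φ) :=
        cutDist_triangle _ _ _
    _ = cutDist f (g.rearrange φ) + cutDist g (h.rearrange ψ) := by rw [cutDist_rearrange]

/-- The space of graphons with the pseudometric `δ_□`. -/
instance : PseudoMetricSpace Graphon where
  dist := cutMetric
  dist_self := cutMetric_self
  dist_comm f g := le_antisymm (cutMetric_comm_le f g) (cutMetric_comm_le g f)
  dist_triangle := cutMetric_triangle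

end Graphon

/-- The quotient of the space of graphons by the relation `δ_□(f,g) = 0`, with the induced
metric `δ_□`. -/
abbrev GraphonSpace : Type := SeparationQuotient Graphon

/-- The equivalence class of a graphon. -/
abbrev Graphon.toClass (f : Graphon) : GraphonSpace := SeparationQuotient.mk f

/-! ### The operator norm -/

namespace Graphon

/-- The kernel operator `(T_f u)(x) = ∫ f(x,y) u(y) dy`. -/
def kernelOp (f : Graphon) (u : I → ℝ) (x : I) : ℝ := ∫ y, f x y * u y

/-- The constants `c ≥ 0` with `‖T_f u‖₂ ≤ c ‖u‖₂` for all `u ∈ L²([0,1])`. -/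
def opBounds (f : Graphon) : Set ℝ :=
  {c | 0 ≤ c ∧ ∀ u : I → ℝ, MemLp u 2 volume →
    eLpNorm (f.kernelOp u) 2 volume ≤ ENNReal.ofReal c * eLpNorm u 2 volume}

/-- The operator norm of `T_f` on `L²([0,1])`. -/
def opNorm (f : Graphon) : ℝ := sInf f.opBounds

lemma abs_sub_le_one (f g : Graphon) (x y : I) : |f x y - g x y| ≤ 1 := by
  have h1 := f.mem_Icc' x y
  have h2 := g.mem_Icc' x y
  rw [abs_le]
  constructor <;> linarith [h1.1, h1.2, h2.1, h2.2]

/-- Cauchy-Schwarz for real functions. -/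
lemma integral_abs_mul_le_sqrt {u v : I → ℝ} (hu : MemLp u 2 volume) (hv : MemLp v 2 volume) :
    ∫ x, |u x| * |v x| ≤ √(∫ x, u x ^ 2) * √(∫ x, v x ^ 2) := by
  have h := integral_mul_norm_le_Lp_mul_Lq (μ := (volume : Measure I)) (f := u) (g := v)
    Real.HolderConjugate.two_two (by simpa using hu) (by simpa using hv)
  simpa [Real.sqrt_eq_rpow] using h

lemma integral_abs_le_sqrt {u : I → ℝ} (hu : MemLp u 2 volume) :
    ∫ x, |u x| ≤ √(∫ x, u x ^ 2) := by
  simpa using integral_abs_mul_le_sqrt hu (memLp_const (1 : ℝ))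

/-- Splitting `∫ |v|` along the sign of `v`. -/
lemma integral_abs_le_of_sets {v : I → ℝ} (hv : Measurable v) (hi : Integrable v) {b : ℝ}
    (hb : ∀ S : Set I, MeasurableSet S → |∫ x in S, v x| ≤ b) : ∫ x, |v x| ≤ 2 * b := by
  have hS : MeasurableSet {x | 0 ≤ v x} := measurableSet_le measurable_const hv
  rw [← integral_add_compl hS hi.abs]
  have h1 : ∫ x in {x | 0 ≤ v x}, |v x| = ∫ x in {x | 0 ≤ v x}, v x :=
    setIntegral_congr_fun hS fun x hx => abs_of_nonneg hx
  have h2 : ∫ x in {x | 0 ≤ v x}ᶜ, |v x| = - ∫ x in {x | 0 ≤ v x}ᶜ, v x := by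
    rw [← integral_neg]
    exact setIntegral_congr_fun hS.compl fun x hx => abs_of_nonpos (not_le.1 (show ¬ 0 ≤ v x from hx)).le
  rw [h1, h2]
  have h3 := (abs_le.1 (hb _ hS)).2
  have h4 := (abs_le.1 (hb _ hS.compl)).1
  linarith

lemma integral_diff_sq_le (f g : Graphon) {u : I → ℝ} (hm : Measurable u)
    (hu : MemLp u 2 volume) :
    ∫ x, (∫ y, (f x y - g x y) * u y) ^ 2 ≤
      2 * √(2 * cutDist f g) * ∫ x, u x ^ 2 := by
  set e : I → I → ℝ := fun x y => f x y - g x y with he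
  have hem : Measurable (Function.uncurry e) := f.measurable'.sub g.measurable'
  have heb : ∀ x y, |e x y| ≤ 1 := abs_sub_le_one f g
  set N := ∫ x, u x ^ 2 with hN
  have hui : Integrable u := hu.integrable (by norm_num)
  have hprod : Integrable (fun z : I × I => e z.1 z.2 * u z.2) := by
    have h1 : Integrable (fun z : I × I => u z.2) := hui.comp_snd volume
    exact h1.bdd_mul (c := 1) hem.aestronglyMeasurable (ae_of_all _ fun z => heb z.1 z.2)
  set v : I → ℝ := fun x => ∫ y, e x y * u y with hv
  have hvm : Measurable v := by
    have : StronglyMeasurable (Function.uncurry fun x y => e x y * u y) :=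
      (hem.mul (hm.comp measurable_snd)).stronglyMeasurable
    exact this.integral_prod_right.measurable
  have hvb : ∀ x, |v x| ≤ √N := fun x => by
    refine le_trans ?_ (integral_abs_le_sqrt hu)
    refine (abs_integral_le_integral_abs).trans ?_
    refine integral_mono_of_nonneg (ae_of_all _ fun y => abs_nonneg _) hui.abs
      (ae_of_all _ fun y => ?_)
    simp only [abs_mul]
    exact mul_le_of_le_one_left (abs_nonneg _) (heb x y)
  have hvi : Integrable v := Integrable.of_bound hvm.aestronglyMeasurable (√N) (ae_of_all _ hvb)
  have hkey : ∀ S : Set I, MeasurableSet S → |∫ x in S, v x| ≤ √N * √(2 * cutDist f g) := by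
    intro S hS
    set w : I → ℝ := fun y => ∫ x in S, e x y with hw
    have hwm : Measurable w := by
      have : StronglyMeasurable (Function.uncurry fun y x => e x y) :=
        (hem.comp measurable_swap).stronglyMeasurable
      exact this.integral_prod_right.measurable
    have hwb : ∀ y, |w y| ≤ 1 := fun y => by
      have h := norm_setIntegral_le_of_norm_le_const (μ := (volume : Measure I)) (s := S)
        (f := fun x => e x y) (C := 1) (measure_lt_top _ _) (fun x _ => heb x y)
      have h3 : (volume : Measure I).real S ≤ 1 := measureReal_le_one
      rw [Real.norm_eq_abs] at h
      exact h.trans (by linarith)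
    have hw2 : MemLp w 2 volume :=
      MemLp.of_bound hwm.aestronglyMeasurable 1 (ae_of_all _ hwb)
    have hwi : Integrable w := hw2.integrable (by norm_num)
    have hwsq : ∫ y, w y ^ 2 ≤ 2 * cutDist f g := by
      refine le_trans ?_ (integral_abs_le_of_sets hwm hwi (b := cutDist f g) ?_)
      · refine integral_mono_of_nonneg (ae_of_all _ fun y => sq_nonneg _) hwi.abs
          (ae_of_all _ fun y => ?_)
        simp only
        rw [← sq_abs, sq]
        exact mul_le_of_le_one_left (abs_nonneg _) (hwb y)
      · intro T hT
        refine le_trans (le_of_eq ?_) (le_cutDist f g hS hT)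
        congr 1
        have : IntegrableOn (fun z : I × I => e z.1 z.2) (S ×ˢ T)
            ((volume : Measure I).prod volume) := (integrable_diff f g).integrableOn
        unfold rectDiff
        have h5 := setIntegral_prod _ this
        refine Eq.trans ?_ h5.symm
        have h6 : Integrable (Function.uncurry e)
          (((volume : Measure I).restrict S).prod ((volume : Measure I).restrict T)) := by
          rw [Measure.prod_restrict]; exact this
        exact (integral_integral_swap h6).symm
    have hswap : ∫ x in S, v x = ∫ y, u y * w y := by
      have h6 : Integrable (Function.uncurry fun x y => e x y * u y)
          (((volume : Measure I).restrict S).prod (volume : Measure I)) := by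
        have h7 : IntegrableOn (fun z : I × I => e z.1 z.2 * u z.2) (S ×ˢ Set.univ)
          ((volume : Measure I).prod volume) := hprod.integrableOn
        rw [IntegrableOn, ← Measure.prod_restrict, Measure.restrict_univ] at h7
        exact h7
      rw [hv]
      simp only
      rw [integral_integral_swap h6]
      refine integral_congr_ae (ae_of_all _ fun y => ?_)
      simp only [hw]
      rw [integral_mul_const, mul_comm]
    rw [hswap]
    refine (abs_integral_le_integral_abs).trans ?_
    simp only [abs_mul]
    refine (integral_abs_mul_le_sqrt hu hw2).trans ?_
    exact mul_le_mul_of_nonneg_left (Real.sqrt_le_sqrt hwsq) (Real.sqrt_nonneg _)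
  have habs := integral_abs_le_of_sets hvm hvi hkey
  have hN0 : 0 ≤ N := integral_nonneg fun x => sq_nonneg _
  calc ∫ x, v x ^ 2 ≤ ∫ x, √N * |v x| := by
        refine integral_mono_of_nonneg (ae_of_all _ fun y => sq_nonneg _)
          (hvi.abs.const_mul _) (ae_of_all _ fun y => ?_)
        simp only
        rw [← sq_abs, sq]
        exact mul_le_mul_of_nonneg_right (hvb y) (abs_nonneg _)
    _ = √N * ∫ x, |v x| := integral_const_mul _ _
    _ ≤ √N * (2 * (√N * √(2 * cutDist f g))) :=
        mul_le_mul_of_nonneg_left habs (Real.sqrt_nonneg _)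
    _ = 2 * √(2 * cutDist f g) * (√N * √N) := by ring
    _ = 2 * √(2 * cutDist f g) * N := by rw [Real.mul_self_sqrt hN0]

lemma measurable_kernelOp (f : Graphon) {u : I → ℝ} (hm : Measurable u) :
    Measurable (f.kernelOp u) := by
  have : StronglyMeasurable (Function.uncurry fun x y => f x y * u y) :=
    (f.measurable'.mul (hm.comp measurable_snd)).stronglyMeasurable
  exact this.integral_prod_right.measurable

lemma eLpNorm_two_eq {u : I → ℝ} (hu : MemLp u 2 volume) :
    eLpNorm u 2 volume = ENNReal.ofReal (√(∫ x, u x ^ 2)) := by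
  have h := hu.eLpNorm_eq_integral_rpow_norm (by norm_num) (by norm_num)
  simpa [Real.sqrt_eq_rpow] using h

/-- Perturbation of the operator norm bounds in the cut distance. -/
lemma opBounds_perturb (f g : Graphon) {c : ℝ} (hc : c ∈ g.opBounds) :
    c + √(2 * √(2 * cutDist f g)) ∈ f.opBounds := by
  refine ⟨add_nonneg hc.1 (Real.sqrt_nonneg _), fun u₀ hu₀ => ?_⟩
  obtain ⟨u, hsm, hae⟩ := hu₀.1
  have hm : Measurable u := hsm.measurable
  have hu : MemLp u 2 volume := (memLp_congr_ae hae).1 hu₀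
  have hk : f.kernelOp u₀ = f.kernelOp u := by
    ext x
    refine integral_congr_ae ?_
    filter_upwards [hae] with y hy
    rw [hy]
  rw [hk, eLpNorm_congr_ae hae]
  have hui : Integrable u := hu.integrable (by norm_num)
  have hint : ∀ (h : Graphon) (x : I), Integrable fun y => h x y * u y := fun h x => by
    refine hui.bdd_mul (c := 1)
      (h.measurable'.comp measurable_prodMk_left).aestronglyMeasurable (ae_of_all _ fun y => ?_)
    have := h.mem_Icc' x y
    rw [Real.norm_eq_abs, abs_le]
    constructor <;> linarith [this.1, this.2]
  set v : I → ℝ := fun x => ∫ y, (f x y - g x y) * u y with hv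
  have hsplit : f.kernelOp u = g.kernelOp u + v := by
    ext x
    simp only [kernelOp, hv, Pi.add_apply, sub_mul]
    rw [integral_sub (hint f x) (hint g x)]
    ring
  have hgm := g.measurable_kernelOp hm
  have hvm : Measurable v := by
    have : v = f.kernelOp u - g.kernelOp u := by rw [hsplit]; simp
    rw [this]
    exact (f.measurable_kernelOp hm).sub hgm
  have hvL : MemLp v 2 volume := by
    refine MemLp.of_bound hvm.aestronglyMeasurable (∫ y, |u y|) (ae_of_all _ fun x => ?_)
    refine (abs_integral_le_integral_abs).trans ?_
    refine integral_mono_of_nonneg (ae_of_all _ fun y => abs_nonneg _) hui.abs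
      (ae_of_all _ fun y => ?_)
    simp only [abs_mul]
    exact mul_le_of_le_one_left (abs_nonneg _) (abs_sub_le_one f g x y)
  have hvn : eLpNorm v 2 volume ≤
      ENNReal.ofReal (√(2 * √(2 * cutDist f g))) * eLpNorm u 2 volume := by
    rw [eLpNorm_two_eq hvL, eLpNorm_two_eq hu, ← ENNReal.ofReal_mul (Real.sqrt_nonneg _),
      ← Real.sqrt_mul (by positivity)]
    exact ENNReal.ofReal_le_ofReal (Real.sqrt_le_sqrt (integral_diff_sq_le f g hm hu))
  rw [hsplit, ENNReal.ofReal_add hc.1 (Real.sqrt_nonneg _), add_mul]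
  exact (eLpNorm_add_le hgm.aestronglyMeasurable hvm.aestronglyMeasurable (by norm_num)).trans
    (add_le_add (hc.2 u hu) hvn)

lemma bddBelow_opBounds (f : Graphon) : BddBelow f.opBounds := ⟨0, fun _ h => h.1⟩

lemma opBounds_rearrange_subset (f : Graphon) (φ : Rearrangement) :
    f.opBounds ⊆ (f.rearrange φ).opBounds := by
  rintro c ⟨hc0, hc⟩
  refine ⟨hc0, fun u hu => ?_⟩
  have hψ : MeasurePreserving φ.1.symm (volume : Measure I) volume := φ.2.symm
  have hw : MemLp (u ∘ φ.1.symm) 2 volume := hu.comp_measurePreserving hψ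
  have h := hc _ hw
  have h1 : eLpNorm (u ∘ φ.1.symm) 2 volume = eLpNorm u 2 volume :=
    eLpNorm_comp_measurePreserving hu.1 hψ
  have h2 : (f.rearrange φ).kernelOp u = f.kernelOp (u ∘ φ.1.symm) ∘ φ.1 := by
    ext x
    have := φ.2.integral_comp φ.1.measurableEmbedding
      (fun y => f (φ.1 x) y * (u ∘ φ.1.symm) y)
    simpa [kernelOp, rearrange] using this
  have h3 : eLpNorm (f.kernelOp (u ∘ φ.1.symm) ∘ φ.1) 2 volume
      = eLpNorm (f.kernelOp (u ∘ φ.1.symm)) 2 volume := by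
    have := eLpNorm_map_measure (μ := (volume : Measure I)) (p := 2)
      (g := f.kernelOp (u ∘ φ.1.symm)) (f := φ.1) ?_ φ.1.measurable.aemeasurable
    · rw [← this, φ.2.map_eq]
    · obtain ⟨w, hsm, hae⟩ := hw.1
      rw [φ.2.map_eq]
      have hk : f.kernelOp (u ∘ φ.1.symm) = f.kernelOp w := by
        ext x
        refine integral_congr_ae ?_
        filter_upwards [hae] with y hy
        rw [hy]
      rw [hk]
      exact (f.measurable_kernelOp hsm.measurable).aestronglyMeasurable
  rw [h2, h3, ← h1]
  exact h

lemma opBounds_nonempty (f : Graphon) : f.opBounds.Nonempty := by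
  let z : Graphon := ⟨fun _ _ => 0, measurable_const, fun _ _ => by simp, fun _ _ => rfl⟩
  have hz : (0 : ℝ) ∈ z.opBounds := by
    refine ⟨le_rfl, fun u _ => ?_⟩
    have : z.kernelOp u = 0 := by
      ext x
      simp [kernelOp, z]
    simp [this]
  exact ⟨_, opBounds_perturb f z hz⟩

lemma opNorm_le_of_dist_zero (f g : Graphon) (h : dist f g = 0) : f.opNorm ≤ g.opNorm := by
  refine le_csInf g.opBounds_nonempty fun c hc => ?_
  refine le_of_forall_pos_le_add fun ε hε => ?_
  have hcont : Continuous fun t : ℝ => √(2 * √(2 * t)) := by fun_prop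
  have hev : ∀ᶠ t in nhds (0 : ℝ), √(2 * √(2 * t)) < ε :=
    hcont.continuousAt.eventually_lt_const (by simpa using hε)
  obtain ⟨η, hη, hb⟩ := Metric.eventually_nhds_iff.1 hev
  obtain ⟨φ, hφ⟩ := exists_lt_of_ciInf_lt (show (⨅ φ : Rearrangement, cutDist f (g.rearrange φ)) < η
    from lt_of_eq_of_lt h hη)
  have h1 := csInf_le f.bddBelow_opBounds
    (opBounds_perturb f (g.rearrange φ) (opBounds_rearrange_subset g φ hc))
  have h2 := hb (y := cutDist f (g.rearrange φ))
    (by simpa [abs_of_nonneg (cutDist_nonneg _ _)] using hφ)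
  exact h1.trans (by linarith)

lemma opNorm_congr (f g : Graphon) (h : Inseparable f g) : f.opNorm = g.opNorm := by
  have h0 := Metric.inseparable_iff.1 h
  exact le_antisymm (opNorm_le_of_dist_zero f g h0)
    (opNorm_le_of_dist_zero g f (by rwa [dist_comm]))

end Graphon

/-- The operator norm as a function on the quotient space of graphons. -/
def GraphonSpace.opNorm : GraphonSpace → ℝ :=
  SeparationQuotient.lift Graphon.opNorm Graphon.opNorm_congr

/-! ### Relative entropy and the rate function -/

/-- The relative entropy `u log (u/p) + (1-u) log ((1-u)/(1-p))`, with `0 log 0 = 0` (and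
`0 log (0/0) = 0`). -/
def relEntropy (p u : ℝ) : ℝ :=
  u * Real.log (u / p) + (1 - u) * Real.log ((1 - u) / (1 - p))

open Classical in
/-- The relative entropy `h_p(u)` for `p, u ∈ [0,1]` with values in `[0,∞]`: it is infinite exactly
when `p = 0 < u` or `u < 1 = p`. -/
def extRelEntropy (p u : ℝ) : ℝ≥0∞ :=
  if (p = 0 ∧ u ≠ 0) ∨ (p = 1 ∧ u ≠ 1) then ⊤ else ENNReal.ofReal (relEntropy p u)

namespace Graphon

/-- `I_{W₀}(f) = (1/2) ∫ h_{W₀(x,y)}(f(x,y)) dx dy`. -/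
def entropy (W₀ f : Graphon) : ℝ≥0∞ :=
  (∫⁻ z : I × I, extRelEntropy (W₀ z.1 z.2) (f z.1 z.2)) / 2

/-- `Ω = {(x,y) : W₀(x,y) ∈ (0,1)}`. -/
def omega (W₀ : Graphon) : Set (I × I) := {z | W₀ z.1 z.2 ∈ Set.Ioo (0 : ℝ) 1}

/-- `𝒲_Ω`: the graphons that agree with `W₀` almost everywhere off `Ω`. -/
def agreeing (W₀ : Graphon) : Set Graphon :=
  {f | volume {z : I × I | z ∈ W₀.omegaᶜ ∧ f z.1 z.2 ≠ W₀ z.1 z.2} = 0}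

/-- The set of classes of graphons in `𝒲_Ω`. -/
def agreeingClasses (W₀ : Graphon) : Set GraphonSpace :=
  {F | ∃ g ∈ W₀.agreeing, dist F g.toClass = 0}

open Classical in
/-- The rate function: `J_{W₀}(F) = sup_{η>0} inf {I_{W₀}(h) : δ_□(F,h) ≤ η}` if `F` is the class
of a graphon in `𝒲_Ω`, and `∞` otherwise. -/
def rate (W₀ : Graphon) (F : GraphonSpace) : ℝ≥0∞ :=
  if F ∈ W₀.agreeingClasses then
    ⨆ (η : ℝ) (_ : 0 < η), ⨅ (h : Graphon) (_ : dist F h.toClass ≤ η), W₀.entropy h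
  else ⊤

/-- `F` is a minimizer of `J_{W₀}` over `{F : τ(F) ≥ t}`. -/
def IsMinimizer (W₀ : Graphon) (τ : GraphonSpace → ℝ) (t : ℝ) (F : GraphonSpace) : Prop :=
  t ≤ τ F ∧ ∀ G : GraphonSpace, t ≤ τ G → W₀.rate F ≤ W₀.rate G

/-- `t_max`, the supremum of `τ` over the classes of graphons in `𝒲_Ω`. -/
def tMax (W₀ : Graphon) (τ : GraphonSpace → ℝ) : ℝ := sSup (τ '' W₀.agreeingClasses)

/-! ### Block graphons and the symmetric regime -/

/-- The `j`-th of the consecutive intervals of lengths `γ₀, γ₁, …`: half-open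
`(γ₀ + … + γ_{j-1}, γ₀ + … + γ_j]`, with the point `0` added for `j = 0`. -/
def blockInterval {m : ℕ} (γ : Fin m → ℝ) (j : Fin m) : Set I :=
  {x | (∑ i ∈ Finset.univ.filter (· < j), γ i < x ∨ ((j : ℕ) = 0 ∧ (x : ℝ) = 0)) ∧
    (x : ℝ) ≤ ∑ i ∈ Finset.univ.filter (· ≤ j), γ i}

/-- `ℬ^γ`: the graphons that are constant on the blocks given by `γ`. -/
def blockGraphons {m : ℕ} (γ : Fin m → ℝ) : Set Graphon :=
  {f | ∃ P : Fin m → Fin m → ℝ, (∀ i j, P i j ∈ Set.Icc (0 : ℝ) 1) ∧ (∀ i j, P i j = P j i) ∧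
    ∀ i j, ∀ x ∈ blockInterval γ i, ∀ y ∈ blockInterval γ j, f x y = P i j}

/-- The set of classes of graphons in `ℬ^γ`. -/
def blockClasses {m : ℕ} (γ : Fin m → ℝ) : Set GraphonSpace :=
  {F | ∃ g ∈ blockGraphons γ, dist F g.toClass = 0}

/-- `t` is in the symmetric regime for the block graphon `W₀` with block lengths `γ` and the graph
parameter `τ`: all minimizers are classes of graphons in `ℬ^γ`. (The notion is meant for
`t ≤ t_max`.) -/
def InSymmetricRegime {m : ℕ} (γ : Fin m → ℝ) (W₀ : Graphon) (τ : GraphonSpace → ℝ) (t : ℝ) :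
    Prop :=
  ∀ F : GraphonSpace, W₀.IsMinimizer τ t F → F ∈ blockClasses γ

/-- The bipartite graphon `f_p^γ`: equal to `0` on `[0,γ]² ∪ (γ,1]²` and to `p` elsewhere. -/
def bipartite (γ p : ℝ) (hp : p ∈ Set.Icc (0 : ℝ) 1) : Graphon where
  toFun x y := if ((x : ℝ) ≤ γ ∧ (y : ℝ) ≤ γ) ∨ (γ < (x : ℝ) ∧ γ < (y : ℝ)) then 0 else p
  measurable' := by
    have h1 : Measurable fun z : I × I => (z.1 : ℝ) := measurable_subtype_coe.comp measurable_fst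
    have h2 : Measurable fun z : I × I => (z.2 : ℝ) := measurable_subtype_coe.comp measurable_snd
    refine Measurable.ite ?_ measurable_const measurable_const
    exact ((measurableSet_le h1 measurable_const).inter
      (measurableSet_le h2 measurable_const)).union
      ((measurableSet_lt measurable_const h1).inter (measurableSet_lt measurable_const h2))
  mem_Icc' x y := by
    split_ifs
    · simp
    · exact hp
  symm' x y := by
    simp only [and_comm]

end Graphon

/-! ### Convex minorant -/

/-- The convex minorant of `ψ` on `s`: the largest convex function on `s` that is at most `ψ`
there. -/
def convexMinorant (s : Set ℝ) (ψ : ℝ → ℝ) (x : ℝ) : ℝ :=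
  sSup {y | ∃ g : ℝ → ℝ, ConvexOn ℝ s g ∧ (∀ z ∈ s, g z ≤ ψ z) ∧ g x = y}

/-- The point `(a,b)` lies on (the graph of) the convex minorant of `ψ` on `s`. -/
def OnConvexMinorant (s : Set ℝ) (ψ : ℝ → ℝ) (a b : ℝ) : Prop :=
  a ∈ s ∧ convexMinorant s ψ a = b

end

/-! ### Relative entropy -/

/-! Write `R` for the off-diagonal region where `f_p^γ` equals `p`; its area is `2γ(1-γ)`. A graphon
of finite entropy vanishes a.e. off `R`, so its operator swaps functions on the two blocks.
Cauchy–Schwarz on each half then bounds the squared operator norm by half of `∫_R f²`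
(`opNorm_sq_le_of_cross`). Equality holds when the kernel on one rectangle depends only on the
variable in one block, because the operator between the blocks then has rank one. The constraint
`‖f‖ ≥ t_r` therefore says at most that the mean of `f²` over `R` is at least `r²`, and the problem
becomes one about the scalar function `x ↦ h_p(√x)`.

A supporting line of the convex minorant at `r²`, read in `u = √x`, is a parabola `k + c(u² - r²) ≤
h_p(u)` with `c ≥ 0`. Integrated over `R`, it gives the lower bound `γ(1-γ)k` for the entropy.

On the minorant, `k = h_p(r)` and `f_r^γ` attains the bound. Uniqueness needs stability, since `J`
is an envelope over nearby graphons: a graphon with almost optimal entropy and almost admissible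
norm must be close to `f_r^γ` in `L¹`. The key point is that the parabola cannot touch `h_p` on both
sides of `r` (`not_touching_both_sides`), so `|u² - r²|` is controlled by the excess entropy and the
excess of `u²` (`exists_deviation_bound`, `toClass_eq_of_rate_le`).

Off the minorant, `k < h_p(r)` and the parabola touches `h_p` at some `u₁ < r < u₂`
(`exists_touching_parabola`). Split the smaller block into two parts, put `u₁` on the rectangle from
one part to the other block and `u₂` on the rectangle from the second part, with proportions making
the mean square `r²`. Both inequalities above become equalities, so this is a minimizer. Its degree
distribution, an invariant of the class, is not that of any block graphon
(`toClass_notMem_blockClasses`). -/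

lemma relEntropy_eq_add {p : ℝ} (hp0 : 0 < p) (hp1 : p < 1) (u : ℝ) :
    relEntropy p u = u * Real.log u + (1 - u) * Real.log (1 - u) +
      u * (Real.log (1 - p) - Real.log p) - Real.log (1 - p) := by
  have h1 : u * Real.log (u / p) = u * Real.log u - u * Real.log p := by
    rcases eq_or_ne u 0 with rfl | hu
    · simp
    · rw [Real.log_div hu hp0.ne']; ring
  have h2 : (1 - u) * Real.log ((1 - u) / (1 - p)) =
      (1 - u) * Real.log (1 - u) - (1 - u) * Real.log (1 - p) := by
    rcases eq_or_ne (1 - u) 0 with hu | hu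
    · simp [hu]
    · rw [Real.log_div hu (sub_pos.2 hp1).ne']; ring
  rw [relEntropy, h1, h2]
  ring

lemma continuous_relEntropy {p : ℝ} (hp0 : 0 < p) (hp1 : p < 1) : Continuous (relEntropy p) := by
  have h : relEntropy p = fun u => u * Real.log u + (1 - u) * Real.log (1 - u) +
      u * (Real.log (1 - p) - Real.log p) - Real.log (1 - p) :=
    funext (relEntropy_eq_add hp0 hp1)
  rw [h]
  have h1 := Real.continuous_mul_log
  have h2 : Continuous fun u : ℝ => (1 - u) * Real.log (1 - u) :=
    h1.comp (continuous_const.sub continuous_id)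
  fun_prop

lemma hasDerivAt_relEntropy {p u : ℝ} (hp0 : 0 < p) (hp1 : p < 1) (hu0 : 0 < u) (hu1 : u < 1) :
    HasDerivAt (relEntropy p)
      (Real.log u - Real.log (1 - u) + (Real.log (1 - p) - Real.log p)) u := by
  have h : relEntropy p = fun u => u * Real.log u + (1 - u) * Real.log (1 - u) +
      u * (Real.log (1 - p) - Real.log p) - Real.log (1 - p) :=
    funext (relEntropy_eq_add hp0 hp1)
  rw [h]
  have h1 := Real.hasDerivAt_mul_log hu0.ne'
  have h2 := (Real.hasDerivAt_mul_log (sub_pos.2 hu1).ne').comp u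
    ((hasDerivAt_const u (1 : ℝ)).sub (hasDerivAt_id u))
  have h3 := ((h1.add h2).add
    ((hasDerivAt_id u).mul_const (Real.log (1 - p) - Real.log p))).sub_const (Real.log (1 - p))
  exact h3.congr_deriv (by simp; ring)

/-- The linear correction terms in the two `klFun` summands cancel, so positivity of `h_p` away from
`p` follows from that of `klFun` away from `1`. -/
lemma relEntropy_eq_klFun {p : ℝ} (hp0 : 0 < p) (hp1 : p < 1) (u : ℝ) :
    relEntropy p u = p * InformationTheory.klFun (u / p) +
      (1 - p) * InformationTheory.klFun ((1 - u) / (1 - p)) := by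
  have h1 := hp0.ne'
  have h2 := (sub_pos.2 hp1).ne'
  rw [InformationTheory.klFun_apply, InformationTheory.klFun_apply, relEntropy]
  field_simp
  ring

lemma relEntropy_nonneg {p u : ℝ} (hp0 : 0 < p) (hp1 : p < 1) (hu : u ∈ Set.Icc (0 : ℝ) 1) :
    0 ≤ relEntropy p u := by
  rw [relEntropy_eq_klFun hp0 hp1]
  have h1 := InformationTheory.klFun_nonneg (div_nonneg hu.1 hp0.le)
  have h2 := InformationTheory.klFun_nonneg (div_nonneg (sub_nonneg.2 hu.2) (sub_pos.2 hp1).le)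
  have h3 := sub_pos.2 hp1
  positivity

lemma relEntropy_pos {p u : ℝ} (hp0 : 0 < p) (hp1 : p < 1) (hu : u ∈ Set.Icc (0 : ℝ) 1)
    (hup : u ≠ p) : 0 < relEntropy p u := by
  rw [relEntropy_eq_klFun hp0 hp1]
  have h0 := div_nonneg hu.1 hp0.le
  have h1 := InformationTheory.klFun_nonneg h0
  have h2 := InformationTheory.klFun_nonneg (div_nonneg (sub_nonneg.2 hu.2) (sub_pos.2 hp1).le)
  have h3 := sub_pos.2 hp1
  have h4 : InformationTheory.klFun (u / p) ≠ 0 := by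
    rw [Ne, InformationTheory.klFun_eq_zero_iff h0, div_eq_one_iff_eq hp0.ne']
    exact hup
  have h5 := h1.lt_of_ne' h4
  positivity

lemma relEntropy_self {p : ℝ} (hp0 : 0 < p) (hp1 : p < 1) : relEntropy p p = 0 := by
  simp [relEntropy, div_self hp0.ne', div_self (sub_pos.2 hp1).ne']

/-! ### Convex minorant -/

section Minorant

variable {s : Set ℝ} {ψ : ℝ → ℝ}

lemma bddAbove_convexMinorant {x : ℝ} (hx : x ∈ s) :
    BddAbove {y | ∃ g : ℝ → ℝ, ConvexOn ℝ s g ∧ (∀ z ∈ s, g z ≤ ψ z) ∧ g x = y} :=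
  ⟨ψ x, by rintro _ ⟨g, -, hg, rfl⟩; exact hg x hx⟩

lemma le_convexMinorant {g : ℝ → ℝ} (hg : ConvexOn ℝ s g) (hle : ∀ z ∈ s, g z ≤ ψ z) {x : ℝ}
    (hx : x ∈ s) : g x ≤ convexMinorant s ψ x :=
  le_csSup (bddAbove_convexMinorant hx) ⟨g, hg, hle, rfl⟩

lemma affine_le_convexMinorant (hs : Convex ℝ s) {b c : ℝ} (hle : ∀ z ∈ s, b + c * z ≤ ψ z)
    {x : ℝ} (hx : x ∈ s) : b + c * x ≤ convexMinorant s ψ x := by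
  refine le_convexMinorant (g := fun z => b + c * z) ⟨hs, fun x _ y _ α β _ _ h => le_of_eq ?_⟩
    hle hx
  simp only [smul_eq_mul]
  linear_combination (-b) * h

lemma convexMinorant_le (hs : Convex ℝ s) (hψ : ∀ z ∈ s, 0 ≤ ψ z) {x : ℝ} (hx : x ∈ s) :
    convexMinorant s ψ x ≤ ψ x :=
  csSup_le ⟨0, fun _ => 0, convexOn_const 0 hs, hψ, rfl⟩
    (by rintro _ ⟨g, -, hg, rfl⟩; exact hg x hx)

lemma convexOn_convexMinorant (hs : Convex ℝ s) (hψ : ∀ z ∈ s, 0 ≤ ψ z) :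
    ConvexOn ℝ s (convexMinorant s ψ) := by
  refine ⟨hs, fun x hx y hy α β hα hβ h => ?_⟩
  refine csSup_le ⟨0, fun _ => 0, convexOn_const 0 hs, hψ, rfl⟩ ?_
  rintro _ ⟨g, hg, hle, rfl⟩
  refine (hg.2 hx hy hα hβ h).trans ?_
  have h1 := le_convexMinorant hg hle hx
  have h2 := le_convexMinorant hg hle hy
  simp only [smul_eq_mul]
  gcongr

/-- The right derivative at an interior point lies between the slopes of the chords on the left and
those on the right. -/
lemma ConvexOn.exists_supporting_line {g : ℝ → ℝ} (hg : ConvexOn ℝ s g) {a : ℝ}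
    (ha : a ∈ interior s) : ∃ c, ∀ x ∈ s, g a + c * (x - a) ≤ g x := by
  refine ⟨derivWithin g (Set.Ioi a) a, fun x hx => ?_⟩
  rcases lt_trichotomy x a with h | rfl | h
  · have h1 := hg.slope_le_leftDeriv_of_mem_interior hx ha h
    have h2 := h1.trans (hg.leftDeriv_le_rightDeriv_of_mem_interior ha)
    rw [slope_def_field, div_le_iff₀ (sub_pos.2 h)] at h2
    linarith
  · simp
  · have h1 := hg.rightDeriv_le_slope_of_mem_interior ha hx h
    rw [slope_def_field, le_div_iff₀ (sub_pos.2 h)] at h1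
    linarith

lemma exists_supporting_line_convexMinorant (hs : Convex ℝ s) (hψ : ∀ z ∈ s, 0 ≤ ψ z) {a : ℝ}
    (ha : a ∈ interior s) : ∃ c, ∀ x ∈ s, convexMinorant s ψ a + c * (x - a) ≤ ψ x := by
  obtain ⟨c, hc⟩ := (convexOn_convexMinorant hs hψ).exists_supporting_line ha
  exact ⟨c, fun x hx => (hc x hx).trans (convexMinorant_le hs hψ hx)⟩

/-- Convexity on a closed interval allows an upward jump at an endpoint: the function that is `0` on
`[0,1)` and `ψ 1` at `1` is convex and below `ψ`. This rules out `r = 1` off the minorant. -/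
lemma convexMinorant_Icc_one (hψ : ∀ z ∈ Set.Icc (0 : ℝ) 1, 0 ≤ ψ z) :
    convexMinorant (Set.Icc 0 1) ψ 1 = ψ 1 := by
  have h1 : (1 : ℝ) ∈ Set.Icc (0 : ℝ) 1 := by simp
  refine le_antisymm (convexMinorant_le (convex_Icc 0 1) hψ h1) ?_
  have key : ConvexOn ℝ (Set.Icc (0 : ℝ) 1) (fun z => if z = 1 then ψ 1 else 0) := by
    refine ⟨convex_Icc 0 1, fun x hx y hy α β hα hβ h => ?_⟩
    have hp := hψ 1 h1
    simp only [smul_eq_mul]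
    by_cases hz : α * x + β * y = 1
    · rw [if_pos hz]
      by_cases hx1 : x = 1
      · by_cases hy1 : y = 1
        · rw [if_pos hx1, if_pos hy1, ← add_mul, h, one_mul]
        · have : β = 0 := by
            by_contra hb
            have : 0 < β * (1 - y) := mul_pos (hβ.lt_of_ne' hb) (sub_pos.2 (hy.2.lt_of_ne hy1))
            subst hx1; linarith
          have : α = 1 := by linarith
          simp [*]
      · have : α = 0 := by
          by_contra hb
          have : 0 < α * (1 - x) := mul_pos (hα.lt_of_ne' hb) (sub_pos.2 (hx.2.lt_of_ne hx1))
          have : 0 ≤ β * (1 - y) := mul_nonneg hβ (sub_nonneg.2 hy.2)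
          linarith
        subst this
        have hβ1 : β = 1 := by linarith
        subst hβ1
        have : y = 1 := by linarith
        simp [this]
    · rw [if_neg hz]
      have h3 : ∀ z : ℝ, 0 ≤ if z = 1 then ψ 1 else 0 := fun z => by split_ifs <;> simp [hp]
      have := h3 x
      have := h3 y
      positivity
  have := le_convexMinorant key (ψ := ψ) (fun z hz => by
    split_ifs with h
    · rw [h]
    · exact hψ z hz) h1
  simpa using this

/-- Where the convex minorant lies strictly below `ψ`, the supporting line touches `ψ` on both
sides. -/
lemma exists_touching_points (hc : ContinuousOn ψ (Set.Icc 0 1)) {a c : ℝ} (ha : a ∈ Set.Ioo (0 : ℝ) 1)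
    (hline : ∀ x ∈ Set.Icc (0 : ℝ) 1, convexMinorant (Set.Icc 0 1) ψ a + c * (x - a) ≤ ψ x)
    (hlt : convexMinorant (Set.Icc 0 1) ψ a < ψ a) :
    (∃ x ∈ Set.Ico 0 a, convexMinorant (Set.Icc 0 1) ψ a + c * (x - a) = ψ x) ∧
      ∃ x ∈ Set.Ioc a 1, convexMinorant (Set.Icc 0 1) ψ a + c * (x - a) = ψ x := by
  set k := convexMinorant (Set.Icc 0 1) ψ a with hk
  have haI : a ∈ Set.Icc (0 : ℝ) 1 := Set.Ioo_subset_Icc_self ha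
  have hDc : ContinuousOn (fun x => ψ x - (k + c * (x - a))) (Set.Icc 0 1) :=
    hc.sub (by fun_prop)
  obtain ⟨δ, hδ, hnear⟩ : ∃ δ > 0, ∀ x ∈ Set.Icc (0 : ℝ) 1, |x - a| < δ →
      0 < ψ x - (k + c * (x - a)) := by
    have h1 := Filter.Tendsto.eventually_const_lt (u := 0) (by simpa using hlt) (hDc a haI)
    obtain ⟨δ, hδ, h2⟩ := Metric.mem_nhdsWithin_iff.1 h1
    exact ⟨δ, hδ, fun x hx hd => h2 ⟨by simpa [Real.dist_eq] using hd, hx⟩⟩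
  -- If `ψ` stays at distance at least `d > 0` above the line on `J`, rotate the line about `b` by
  -- slope `d/2`. It rises by at most `d` on `J`, since `|b - x| ≤ 2`, and does not rise outside
  -- `J`. So it remains below `ψ` but is higher at `a`, contradicting the definition of the
  -- minorant. The sign `τ` selects the side.
  have tilt : ∀ J : Set ℝ, J ⊆ Set.Icc 0 1 → IsCompact J → J.Nonempty → ∀ b τ : ℝ, |τ| = 1 →
      0 < τ * (b - a) → (∀ x ∈ J, 0 < ψ x - (k + c * (x - a))) →
      (∀ x ∈ Set.Icc (0 : ℝ) 1, x ∉ J → τ * (b - x) ≤ 0) → |b| ≤ 1 → False := by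
    intro J hJ hJc hJn b τ hτ hb hpos hout hb1
    obtain ⟨x₀, hx₀, hmin⟩ := hJc.exists_isMinOn hJn (hDc.mono hJ)
    set d := ψ x₀ - (k + c * (x₀ - a)) with hd
    have hd0 : 0 < d := hpos x₀ hx₀
    have hle : ∀ z ∈ Set.Icc (0 : ℝ) 1,
        (k - c * a + d / 2 * (τ * b)) + (c - d / 2 * τ) * z ≤ ψ z := by
      intro z hz
      by_cases hzJ : z ∈ J
      · have h1 : d ≤ ψ z - (k + c * (z - a)) := hmin hzJ
        have h2 : τ * (b - z) ≤ 2 := by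
          refine (le_abs_self _).trans ?_
          rw [abs_mul, hτ, one_mul]
          refine (abs_sub _ _).trans ?_
          have : |z| ≤ 1 := by rw [abs_of_nonneg hz.1]; exact hz.2
          linarith
        nlinarith
      · have h1 := hout z hz hzJ
        have h2 := hline z hz
        nlinarith
    have h3 := affine_le_convexMinorant (convex_Icc 0 1) hle haI
    rw [← hk] at h3
    nlinarith
  constructor
  · by_contra! hne
    -- With no contact to the left of `a`, the pivot goes slightly to the right of `a`, within the
    -- neighbourhood where `ψ` is still strictly above the line.
    have hb : a < min (a + δ / 2) 1 := lt_min (by linarith) ha.2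
    refine tilt (Set.Icc 0 (min (a + δ / 2) 1)) (Set.Icc_subset_Icc_right (min_le_right _ _))
      isCompact_Icc ⟨a, ha.1.le, hb.le⟩ (min (a + δ / 2) 1) 1 (by simp) (by linarith) ?_ ?_ ?_
    · intro x hx
      have hxI : x ∈ Set.Icc (0 : ℝ) 1 := ⟨hx.1, hx.2.trans (min_le_right _ _)⟩
      rcases lt_or_ge x a with h | h
      · exact sub_pos.2 ((hline x hxI).lt_of_ne (hne x ⟨hx.1, h⟩))
      · refine hnear x hxI ?_
        rw [abs_of_nonneg (by linarith)]
        have := hx.2.trans (min_le_left _ _)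
        linarith
    · intro x hx hxJ
      by_contra! h
      exact hxJ ⟨hx.1, by linarith⟩
    · rw [abs_of_nonneg (by linarith [ha.1])]
      exact min_le_right _ _
  · by_contra! hne
    have hb : max (a - δ / 2) 0 < a := max_lt (by linarith) ha.1
    refine tilt (Set.Icc (max (a - δ / 2) 0) 1) (Set.Icc_subset_Icc_left (le_max_right _ _))
      isCompact_Icc ⟨a, hb.le, ha.2.le⟩ (max (a - δ / 2) 0) (-1) (by simp) (by linarith) ?_ ?_ ?_
    · intro x hx
      have hxI : x ∈ Set.Icc (0 : ℝ) 1 := ⟨(le_max_right _ _).trans hx.1, hx.2⟩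
      rcases lt_or_ge a x with h | h
      · exact sub_pos.2 ((hline x hxI).lt_of_ne (hne x ⟨h, hx.2⟩))
      · refine hnear x hxI ?_
        rw [abs_of_nonpos (by linarith)]
        have := (le_max_left _ _).trans hx.1
        linarith
    · intro x hx hxJ
      by_contra! h
      exact hxJ ⟨by linarith, hx.2⟩
    · rw [abs_of_nonneg (le_max_right _ _)]
      linarith [ha.2]

end Minorant

/-! ### Parabolas supporting the relative entropy -/

/-- A supporting parabola `u ↦ h_p(r) + c (u² - r²)` of `h_p` does not touch `h_p` on both sides
of `r`. -/
lemma not_touching_both_sides {p r c u₁ u₂ : ℝ} (hp0 : 0 < p) (hp1 : p < 1) (hc : 0 ≤ c)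
    (hD : ∀ u ∈ Set.Icc (0 : ℝ) 1, 0 ≤ relEntropy p u - relEntropy p r - c * (u ^ 2 - r ^ 2))
    (h0 : 0 ≤ u₁) (h1 : u₁ < r) (h2 : r < u₂) (h3 : u₂ ≤ 1)
    (hz1 : relEntropy p u₁ - relEntropy p r - c * (u₁ ^ 2 - r ^ 2) = 0)
    (hz2 : relEntropy p u₂ - relEntropy p r - c * (u₂ ^ 2 - r ^ 2) = 0) : False := by
  set D : ℝ → ℝ := fun u => relEntropy p u - relEntropy p r - c * (u ^ 2 - r ^ 2) with hDdef
  set K := Real.log (1 - p) - Real.log p with hK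
  have hDc : Continuous D := by
    have := continuous_relEntropy hp0 hp1
    fun_prop
  -- The derivative of `D` tends to `-∞` at `0`, so contact at `0` would make `D` negative nearby.
  -- The point `v = exp(-|K| - 1)` is small enough that `v log v + vK ≤ -v`.
  have hu1 : u₁ ≠ 0 := by
    rintro rfl
    set v := Real.exp (-|K| - 1) with hv
    have hv0 : 0 < v := Real.exp_pos _
    have hv1 : v < 1 := Real.exp_lt_one_iff.2 (by have := abs_nonneg K; linarith)
    have h4 := hD v ⟨hv0.le, hv1.le⟩
    have h5 : Real.log v = -|K| - 1 := Real.log_exp _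
    have h6 : (1 - v) * Real.log (1 - v) ≤ 0 :=
      mul_nonpos_of_nonneg_of_nonpos (by linarith) (Real.log_nonpos (by linarith) (by linarith))
    rw [relEntropy_eq_add hp0 hp1 v, h5, ← hK] at h4
    rw [relEntropy_eq_add hp0 hp1 0] at hz1
    simp only [zero_mul, sub_zero, Real.log_one, mul_zero, zero_add, zero_sub] at hz1
    have h7 : v * (K - |K|) ≤ 0 :=
      mul_nonpos_of_nonneg_of_nonpos hv0.le (by linarith [le_abs_self K])
    have h8 : 0 ≤ c * v ^ 2 := by positivity
    nlinarith
  have hu1' : 0 < u₁ := h0.lt_of_ne' hu1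
  set k : ℝ → ℝ := fun u => Real.log u - Real.log (1 - u) + K - 2 * c * u with hk
  have hDd : ∀ u, 0 < u → u < 1 → HasDerivAt D (k u) u := fun u hu hu' => by
    have h4 := ((hasDerivAt_relEntropy hp0 hp1 hu hu').sub_const (relEntropy p r)).sub
      ((((hasDerivAt_pow 2 u).sub_const (r ^ 2))).const_mul c)
    exact h4.congr_deriv (by simp [hk, hK]; ring)
  have hkd : ∀ u, 0 < u → u < 1 → HasDerivAt k (1 / u + 1 / (1 - u) - 2 * c) u := fun u hu hu' => by
    have h4 := ((((Real.hasDerivAt_log hu.ne').sub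
      (((hasDerivAt_const u (1 : ℝ)).sub (hasDerivAt_id u)).log (sub_pos.2 hu').ne')).add_const
        K)).sub ((hasDerivAt_id u).const_mul (2 * c))
    exact h4.congr_deriv (by simp; field_simp; ring)
  have hDr : D r = 0 := by simp [hDdef]
  have crit : ∀ u, 0 < u → u < 1 → D u = 0 → k u = 0 := fun u hu hu' hDu => by
    refine IsLocalMin.hasDerivAt_eq_zero ?_ (hDd u hu hu')
    filter_upwards [Icc_mem_nhds hu hu'] with v hv
    rw [hDu]
    exact hD v hv
  have hk1 := crit u₁ hu1' (by linarith) hz1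
  have hkr := crit r (by linarith) (by linarith) hDr
  -- The derivative `k` vanishes at `u₁` and `r`, which are interior minima of `D`, and by Rolle at
  -- points `m₁`, `m₂` of the two gaps. Contact at `u₂` gives no critical point, as `u₂` may be `1`.
  -- Four zeros of `k` give three zeros of `k'`, but these solve the quadratic `2c z(1 - z) = 1`.
  obtain ⟨m₁, hm₁, hkm₁⟩ := exists_hasDerivAt_eq_zero h1 hDc.continuousOn (hz1.trans hDr.symm)
    (fun x hx => hDd x (by linarith [hx.1]) (by linarith [hx.2]))
  obtain ⟨m₂, hm₂, hkm₂⟩ := exists_hasDerivAt_eq_zero h2 hDc.continuousOn (hDr.trans hz2.symm)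
    (fun x hx => hDd x (by linarith [hx.1]) (by linarith [hx.2]))
  have rolle : ∀ x y, 0 < x → x < y → y < 1 → k x = 0 → k y = 0 →
      ∃ z ∈ Set.Ioo x y, 2 * c * (z * (1 - z)) = 1 := by
    intro x y hx hxy hy hkx hky
    obtain ⟨z, hz, hz'⟩ := exists_hasDerivAt_eq_zero hxy
      (fun z hz => (hkd z (by linarith [hz.1]) (by linarith [hz.2])).continuousAt.continuousWithinAt)
      (hkx.trans hky.symm) (fun z hz => hkd z (by linarith [hz.1]) (by linarith [hz.2]))
    refine ⟨z, hz, ?_⟩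
    have hz0 : z ≠ 0 := by linarith [hz.1]
    have hz1 : 1 - z ≠ 0 := by linarith [hz.2]
    field_simp at hz'
    linarith
  obtain ⟨c₁, hc₁, e₁⟩ := rolle u₁ m₁ hu1' hm₁.1 (by linarith [hm₁.2]) hk1 hkm₁
  obtain ⟨c₂, hc₂, e₂⟩ := rolle m₁ r (by linarith [hm₁.1]) hm₁.2 (by linarith) hkm₁ hkr
  obtain ⟨c₃, hc₃, e₃⟩ := rolle r m₂ (by linarith) hm₂.1 (by linarith [hm₂.2]) hkr hkm₂
  have hc0 : c ≠ 0 := by rintro rfl; simp at e₁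
  have s12 : c₁ + c₂ = 1 := by
    have h4 : 2 * c * (c₁ - c₂) * (c₁ + c₂ - 1) = 0 := by linear_combination e₂ - e₁
    have h5 : 2 * c * (c₁ - c₂) ≠ 0 := by
      have : c₁ - c₂ ≠ 0 := by linarith [hc₁.2, hc₂.1]
      positivity
    have := (mul_eq_zero.1 h4).resolve_left h5
    linarith
  have s23 : c₂ + c₃ = 1 := by
    have h4 : 2 * c * (c₂ - c₃) * (c₂ + c₃ - 1) = 0 := by linear_combination e₃ - e₂
    have h5 : 2 * c * (c₂ - c₃) ≠ 0 := by
      have : c₂ - c₃ ≠ 0 := by linarith [hc₂.2, hc₃.1]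
      positivity
    have := (mul_eq_zero.1 h4).resolve_left h5
    linarith
  linarith [hc₁.2, hc₂.1, hc₂.2, hc₃.1]

/-- On the compact set where `w ≥ ε` the function `D` has a positive minimum, so `C = max w / min D`
works there. Elsewhere `ε` suffices. -/
lemma exists_le_add_mul {D w : ℝ → ℝ} (hD : Continuous D) (hw : Continuous w)
    (hD0 : ∀ u ∈ Set.Icc (0 : ℝ) 1, 0 ≤ D u)
    (h : ∀ u ∈ Set.Icc (0 : ℝ) 1, D u = 0 → w u ≤ 0) {ε : ℝ} (hε : 0 < ε) :
    ∃ C, 0 ≤ C ∧ ∀ u ∈ Set.Icc (0 : ℝ) 1, w u ≤ ε + C * D u := by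
  have hKc : IsCompact (Set.Icc (0 : ℝ) 1 ∩ {u | ε ≤ w u}) :=
    isCompact_Icc.inter_right (isClosed_le continuous_const hw)
  rcases (Set.Icc (0 : ℝ) 1 ∩ {u | ε ≤ w u}).eq_empty_or_nonempty with he | hne
  · refine ⟨0, le_rfl, fun u hu => ?_⟩
    by_contra! hlt
    have : u ∈ Set.Icc (0 : ℝ) 1 ∩ {u | ε ≤ w u} := ⟨hu, by simp at hlt; exact hlt.le⟩
    simp [he] at this
  · obtain ⟨x, hx, hmin⟩ := hKc.exists_isMinOn hne hD.continuousOn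
    obtain ⟨y, hy, hmax⟩ := hKc.exists_isMaxOn hne hw.continuousOn
    have hDx : 0 < D x := (hD0 x hx.1).lt_of_ne' fun h0 => by
      have h1 := h x hx.1 h0
      have h2 : ε ≤ w x := hx.2
      linarith
    have hwy : 0 < w y := hε.trans_le hy.2
    refine ⟨w y / D x, by positivity, fun u hu => ?_⟩
    have hDu := hD0 u hu
    rcases lt_or_ge (w u) ε with hlt | hge
    · have : 0 ≤ w y / D x * D u := by positivity
      linarith
    · have h1 : D x ≤ D u := hmin ⟨hu, hge⟩
      have h2 : w u ≤ w y := hmax ⟨hu, hge⟩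
      have h3 : w y ≤ w y / D x * D u := by
        rw [div_mul_eq_mul_div, le_div_iff₀ hDx]
        gcongr
      linarith

/-- On the convex minorant, the deviation of `u²` from `r²` is controlled by the excess entropy and
the excess of `u²`. -/
lemma exists_deviation_bound {p r : ℝ} (hp0 : 0 < p) (hp1 : p < 1) (hpr : p ≤ r) (hr1 : r ≤ 1)
    (h : OnConvexMinorant (Set.Icc 0 1) (fun x => relEntropy p (√x)) (r ^ 2) (relEntropy p r))
    {ε : ℝ} (hε : 0 < ε) :
    ∃ A B : ℝ, 0 ≤ A ∧ 0 ≤ B ∧ ∀ u ∈ Set.Icc (0 : ℝ) 1,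
      |u ^ 2 - r ^ 2| ≤ ε + A * (relEntropy p u - relEntropy p r) - B * (u ^ 2 - r ^ 2) := by
  have hr0 : 0 < r := hp0.trans_le hpr
  rcases hr1.eq_or_lt with rfl | hr1
  · refine ⟨0, 1, le_rfl, zero_le_one, fun u hu => ?_⟩
    rw [abs_of_nonpos (by nlinarith [hu.1, hu.2])]
    linarith
  have hent := continuous_relEntropy hp0 hp1
  obtain ⟨c, hc0, hcD, hcpos⟩ : ∃ c, 0 ≤ c ∧ (∀ u ∈ Set.Icc (0 : ℝ) 1,
      0 ≤ relEntropy p u - relEntropy p r - c * (u ^ 2 - r ^ 2)) ∧ (p < r → 0 < c) := by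
    rcases hpr.eq_or_lt with rfl | hpr
    · refine ⟨0, le_rfl, fun u hu => ?_, fun h => absurd h (lt_irrefl _)⟩
      rw [relEntropy_self hp0 hp1]
      simpa using relEntropy_nonneg hp0 hp1 hu
    · obtain ⟨c, hc⟩ := exists_supporting_line_convexMinorant (convex_Icc 0 1)
        (ψ := fun x => relEntropy p (√x)) (fun z hz => relEntropy_nonneg hp0 hp1
          ⟨Real.sqrt_nonneg _, Real.sqrt_le_one.2 hz.2⟩) (a := r ^ 2)
        (by rw [interior_Icc]; exact ⟨by positivity, by nlinarith⟩)
      rw [h.2] at hc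
      have hcD : ∀ u ∈ Set.Icc (0 : ℝ) 1,
          0 ≤ relEntropy p u - relEntropy p r - c * (u ^ 2 - r ^ 2) := fun u hu => by
        have := hc (u ^ 2) ⟨by positivity, by nlinarith [hu.1, hu.2]⟩
        simp only [Real.sqrt_sq hu.1] at this
        linarith
      have hcpos : 0 < c := by
        have h1 := hcD p ⟨hp0.le, hp1.le⟩
        have h2 := relEntropy_pos hp0 hp1 ⟨hr0.le, hr1.le⟩ hpr.ne'
        rw [relEntropy_self hp0 hp1] at h1
        have h3 : 0 < r ^ 2 - p ^ 2 := by nlinarith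
        by_contra! hle
        nlinarith
      exact ⟨c, hcpos.le, hcD, fun _ => hcpos⟩
  set D : ℝ → ℝ := fun u => relEntropy p u - relEntropy p r - c * (u ^ 2 - r ^ 2) with hD
  have hDc : Continuous D := by fun_prop
  -- All contact points lie on one side of `r`. If they lie on the left, `|u² - r²| + (u² - r²)`
  -- vanishes at them and is bounded by `ε + C D`.
  by_cases hcase : ∀ u ∈ Set.Icc (0 : ℝ) 1, D u = 0 → u ≤ r
  · obtain ⟨C, hC, hb⟩ := exists_le_add_mul (w := fun u => |u ^ 2 - r ^ 2| + (u ^ 2 - r ^ 2))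
      hDc (by fun_prop) hcD (fun u hu h0 => by
        rw [abs_of_nonpos (by nlinarith [hcase u hu h0, hu.1])]; linarith) hε
    refine ⟨C, C * c + 1, hC, by positivity, fun u hu => ?_⟩
    have := hb u hu
    simp only [hD] at this
    linarith
  · push Not at hcase
    obtain ⟨u₂, hu₂, hz₂, hlt⟩ := hcase
    -- Contact to the right of `r` excludes `r = p`: minimality at `p`, where `h_p' = 0`, forces `c
    -- = 0`, and then `D = h_p` vanishes only at `p`.
    have hpr' : p < r := by
      refine hpr.lt_of_ne ?_
      rintro rfl
      have h1 : HasDerivAt D (0 - c * (2 * p)) p := by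
        have h4 := ((hasDerivAt_relEntropy hp0 hp1 hp0 hp1).sub_const (relEntropy p p)).sub
          ((((hasDerivAt_pow 2 p).sub_const (p ^ 2))).const_mul c)
        exact h4.congr_deriv (by simp)
      have h2 : IsLocalMin D p := by
        filter_upwards [Icc_mem_nhds hp0 hp1] with v hv
        have : D p = 0 := by simp [hD]
        rw [this]
        exact hcD v hv
      have h3 := h2.hasDerivAt_eq_zero h1
      have h4 : c = 0 := by
        have : c * p = 0 := by linarith
        exact (mul_eq_zero.1 this).resolve_right hp0.ne'
      have h5 := relEntropy_pos hp0 hp1 hu₂ hlt.ne'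
      simp only [hD, h4, relEntropy_self hp0 hp1] at hz₂
      linarith
    have hc' := hcpos hpr'
    have hcase : ∀ u ∈ Set.Icc (0 : ℝ) 1, D u = 0 → r ≤ u := fun u hu hz => by
      by_contra! hur
      exact not_touching_both_sides hp0 hp1 hc0 hcD hu.1 hur hlt hu₂.2 hz hz₂
    obtain ⟨C, hC, hb⟩ := exists_le_add_mul (w := fun u => |u ^ 2 - r ^ 2| - (u ^ 2 - r ^ 2))
      hDc (by fun_prop) hcD (fun u hu h0 => by
        rw [abs_of_nonneg (by nlinarith [hcase u hu h0, hu.1])]; linarith) hε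
    -- Contact on the right gives a bound only for `|u² - r²| - (u² - r²)`. The missing `u² - r²` is
    -- paid for by entropy, using `c (u² - r²) ≤ h_p(u) - h_p(r)` and `c > 0`.
    refine ⟨C + 1 / c, C * c, by positivity, by positivity, fun u hu => ?_⟩
    have h1 := hb u hu
    have h2 : u ^ 2 - r ^ 2 ≤ 1 / c * (relEntropy p u - relEntropy p r) := by
      rw [one_div, inv_mul_eq_div, le_div_iff₀ hc']
      linarith [hcD u hu]
    simp only [hD] at h1
    linarith

/-- Off the convex minorant, a parabola strictly below `h_p(r)` at `r` supports `h_p` and touches it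
on both sides of `r`. -/
lemma exists_touching_parabola {p r : ℝ} (hp0 : 0 < p) (hp1 : p < 1) (hpr : p ≤ r) (hr1 : r ≤ 1)
    (h : ¬ OnConvexMinorant (Set.Icc 0 1) (fun x => relEntropy p (√x)) (r ^ 2) (relEntropy p r)) :
    ∃ k c u₁ u₂ : ℝ, 0 ≤ c ∧ 0 ≤ u₁ ∧ u₁ < r ∧ r < u₂ ∧ u₂ ≤ 1 ∧
      (∀ u ∈ Set.Icc (0 : ℝ) 1, k + c * (u ^ 2 - r ^ 2) ≤ relEntropy p u) ∧
      relEntropy p u₁ = k + c * (u₁ ^ 2 - r ^ 2) ∧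
      relEntropy p u₂ = k + c * (u₂ ^ 2 - r ^ 2) := by
  have hr0 : 0 < r := hp0.trans_le hpr
  set ψ : ℝ → ℝ := fun x => relEntropy p (√x) with hψdef
  have hψ : ∀ z ∈ Set.Icc (0 : ℝ) 1, 0 ≤ ψ z := fun z hz => relEntropy_nonneg hp0 hp1
    ⟨Real.sqrt_nonneg _, Real.sqrt_le_one.2 hz.2⟩
  have hψsq : ∀ u, 0 ≤ u → ψ (u ^ 2) = relEntropy p u := fun u hu => by
    simp only [hψdef, Real.sqrt_sq hu]
  have hψc : Continuous ψ := (continuous_relEntropy hp0 hp1).comp Real.continuous_sqrt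
  have hrI : r ^ 2 ∈ Set.Icc (0 : ℝ) 1 := ⟨by positivity, by nlinarith⟩
  have hle := convexMinorant_le (convex_Icc 0 1) hψ hrI
  have hlt : convexMinorant (Set.Icc 0 1) ψ (r ^ 2) < ψ (r ^ 2) := by
    refine hle.lt_of_ne fun he => h ⟨hrI, he.trans (hψsq r hr0.le)⟩
  have hr1' : r < 1 := by
    refine hr1.lt_of_ne ?_
    rintro rfl
    rw [one_pow, convexMinorant_Icc_one hψ] at hlt
    exact lt_irrefl _ hlt
  have hk0 : 0 ≤ convexMinorant (Set.Icc 0 1) ψ (r ^ 2) :=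
    le_convexMinorant (convexOn_const 0 (convex_Icc 0 1)) hψ hrI
  have hpr' : p < r := by
    refine hpr.lt_of_ne ?_
    rintro rfl
    rw [hψsq p hp0.le, relEntropy_self hp0 hp1] at hlt
    linarith
  have hrO : r ^ 2 ∈ Set.Ioo (0 : ℝ) 1 := ⟨by positivity, by nlinarith⟩
  obtain ⟨c, hc⟩ := exists_supporting_line_convexMinorant (convex_Icc 0 1) hψ (a := r ^ 2)
    (by rw [interior_Icc]; exact hrO)
  obtain ⟨⟨x₁, hx₁, e₁⟩, x₂, hx₂, e₂⟩ := exists_touching_points hψc.continuousOn hrO hc hlt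
  -- At `u = p` the entropy is `0`, so `c (r² - p²) ≥ k ≥ 0`.
  have hc0 : 0 ≤ c := by
    have h1 := hc (p ^ 2) ⟨by positivity, by nlinarith⟩
    rw [hψsq p hp0.le, relEntropy_self hp0 hp1] at h1
    have h3 : 0 < r ^ 2 - p ^ 2 := by nlinarith
    by_contra! hle
    nlinarith
  refine ⟨convexMinorant (Set.Icc 0 1) ψ (r ^ 2), c, √x₁, √x₂, hc0, Real.sqrt_nonneg _, ?_, ?_,
    Real.sqrt_le_one.2 hx₂.2, fun u hu => ?_, ?_, ?_⟩
  · exact (Real.sqrt_lt' hr0).2 hx₁.2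
  · exact (Real.lt_sqrt hr0.le).2 hx₂.1
  · rw [← hψsq u hu.1]
    exact hc _ ⟨by positivity, by nlinarith [hu.1, hu.2]⟩
  · rw [Real.sq_sqrt hx₁.1, e₁]
  · rw [Real.sq_sqrt (by linarith [hx₂.1, hrI.1]), e₂]

namespace Graphon

/-! ### The operator norm and the degrees -/

lemma integrable_comp {φ : ℝ → ℝ} (hφ : Continuous φ) (f : Graphon) :
    Integrable fun z : I × I => φ (f z.1 z.2) := by
  obtain ⟨C, hC⟩ := isCompact_Icc.exists_bound_of_continuousOn (s := Set.Icc (0 : ℝ) 1)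
    hφ.continuousOn
  exact Integrable.of_bound (hφ.measurable.comp f.measurable').aestronglyMeasurable C
    (ae_of_all _ fun z => hC _ (f.mem_Icc' _ _))

lemma opNorm_nonneg (f : Graphon) : 0 ≤ f.opNorm :=
  le_csInf f.opBounds_nonempty fun _ h => h.1

lemma opNorm_le_add_of_cutDist (f g : Graphon) :
    f.opNorm ≤ g.opNorm + √(2 * √(2 * cutDist f g)) := by
  rw [← sub_le_iff_le_add]
  refine le_csInf g.opBounds_nonempty fun c hc => ?_
  rw [sub_le_iff_le_add]
  exact csInf_le f.bddBelow_opBounds (opBounds_perturb f g hc)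

lemma opNorm_rearrange_le (f : Graphon) (φ : Rearrangement) :
    (f.rearrange φ).opNorm ≤ f.opNorm :=
  csInf_le_csInf (bddBelow_opBounds _) f.opBounds_nonempty (opBounds_rearrange_subset f φ)

lemma opNorm_le_add_of_dist_lt {f g : Graphon} {η : ℝ} (h : dist f g < η) :
    f.opNorm ≤ g.opNorm + √(2 * √(2 * η)) := by
  obtain ⟨φ, hφ⟩ := exists_lt_of_ciInf_lt
    (show (⨅ φ : Rearrangement, cutDist f (g.rearrange φ)) < η from h)
  refine (opNorm_le_add_of_cutDist f (g.rearrange φ)).trans ?_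
  gcongr
  exact opNorm_rearrange_le g φ

/-- Comparison with the zero graphon, at cut distance at most `1`. Any uniform bound would do: it
makes the supremum defining `tMax` one of a bounded set. -/
lemma opNorm_le_const (f : Graphon) : f.opNorm ≤ √(2 * √(2 * 1)) := by
  let z : Graphon := ⟨fun _ _ => 0, measurable_const, fun _ _ => by simp, fun _ _ => rfl⟩
  have hz : (0 : ℝ) ∈ z.opBounds := by
    refine ⟨le_rfl, fun u _ => ?_⟩
    have : z.kernelOp u = 0 := by
      ext x
      simp [kernelOp, z]
    simp [this]
  refine (csInf_le f.bddBelow_opBounds (opBounds_perturb f z hz)).trans ?_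
  rw [zero_add]
  gcongr
  exact ciSup_le fun _ => abs_rectDiff_le_one _ _ _ _

lemma abs_kernelOp_le (f : Graphon) {u : I → ℝ} (hu : MemLp u 2 volume) (x : I) :
    |f.kernelOp u x| ≤ √(∫ y, u y ^ 2) := by
  refine le_trans ?_ (integral_abs_le_sqrt hu)
  refine abs_integral_le_integral_abs.trans ?_
  refine integral_mono_of_nonneg (ae_of_all _ fun y => abs_nonneg _)
    (hu.integrable (by norm_num)).abs (ae_of_all _ fun y => ?_)
  simp only [abs_mul]
  refine mul_le_of_le_one_left (abs_nonneg _) ?_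
  have := f.mem_Icc' x y
  rw [abs_of_nonneg this.1]
  exact this.2

lemma memLp_kernelOp (f : Graphon) {u : I → ℝ} (hm : Measurable u) (hu : MemLp u 2 volume) :
    MemLp (f.kernelOp u) 2 volume :=
  MemLp.of_bound (f.measurable_kernelOp hm).aestronglyMeasurable _
    (ae_of_all _ (f.abs_kernelOp_le hu))

lemma mem_opBounds_of_sq {f : Graphon} {c : ℝ} (hc : 0 ≤ c)
    (h : ∀ u : I → ℝ, Measurable u → MemLp u 2 volume →
      ∫ x, f.kernelOp u x ^ 2 ≤ c ^ 2 * ∫ x, u x ^ 2) : c ∈ f.opBounds := by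
  refine ⟨hc, fun u₀ hu₀ => ?_⟩
  obtain ⟨u, hsm, hae⟩ := hu₀.1
  have hm : Measurable u := hsm.measurable
  have hu : MemLp u 2 volume := (memLp_congr_ae hae).1 hu₀
  have hk : f.kernelOp u₀ = f.kernelOp u := by
    ext x
    refine integral_congr_ae ?_
    filter_upwards [hae] with y hy
    rw [hy]
  rw [hk, eLpNorm_congr_ae hae, eLpNorm_two_eq hu, eLpNorm_two_eq (f.memLp_kernelOp hm hu),
    ← ENNReal.ofReal_mul hc]
  refine ENNReal.ofReal_le_ofReal ?_
  conv_rhs => rw [← Real.sqrt_sq hc, ← Real.sqrt_mul (sq_nonneg c)]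
  exact Real.sqrt_le_sqrt (h u hm hu)

lemma integral_kernelOp_sq_le {f : Graphon} {c : ℝ} (hc : c ∈ f.opBounds) {u : I → ℝ}
    (hm : Measurable u) (hu : MemLp u 2 volume) :
    ∫ x, f.kernelOp u x ^ 2 ≤ c ^ 2 * ∫ x, u x ^ 2 := by
  have h := hc.2 u hu
  rw [eLpNorm_two_eq hu, eLpNorm_two_eq (f.memLp_kernelOp hm hu), ← ENNReal.ofReal_mul hc.1,
    ENNReal.ofReal_le_ofReal_iff (mul_nonneg hc.1 (Real.sqrt_nonneg _)),
    Real.sqrt_le_left (mul_nonneg hc.1 (Real.sqrt_nonneg _)), mul_pow,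
    Real.sq_sqrt (integral_nonneg fun x => sq_nonneg _)] at h
  exact h

/-- The degree function of a graphon. -/
noncomputable def degree (f : Graphon) (x : I) : ℝ := ∫ y, f x y

lemma measurable_degree (f : Graphon) : Measurable f.degree := by
  have : StronglyMeasurable (Function.uncurry f.toFun) := f.measurable'.stronglyMeasurable
  exact this.integral_prod_right.measurable

lemma abs_degree_le (f : Graphon) (x : I) : |f.degree x| ≤ 1 := by
  have h := norm_integral_le_of_norm_le_const (μ := (volume : Measure I)) (f := f x) (C := 1)
    (ae_of_all _ fun y => by
      have := f.mem_Icc' x y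
      rw [Real.norm_eq_abs, abs_of_nonneg this.1]
      exact this.2)
  simpa [degree] using h

lemma integrable_comp_degree {Φ : ℝ → ℝ} (hΦ : Continuous Φ) (f : Graphon) :
    Integrable fun x => Φ (f.degree x) := by
  obtain ⟨C, hC⟩ := isCompact_Icc.exists_bound_of_continuousOn (s := Set.Icc (-1 : ℝ) 1)
    hΦ.continuousOn
  exact Integrable.of_bound (hΦ.measurable.comp f.measurable_degree).aestronglyMeasurable C
    (ae_of_all _ fun x => hC _ (abs_le.1 (f.abs_degree_le x)))

/-- Integrating the degree difference over `S` is testing the cut distance on `S × [0,1]`. The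
factor `2` comes from the two sign sets. -/
lemma integral_abs_degree_sub_le (f g : Graphon) :
    ∫ x, |f.degree x - g.degree x| ≤ 2 * cutDist f g := by
  have hf := integrable_comp_degree continuous_id f
  have hg := integrable_comp_degree continuous_id g
  refine integral_abs_le_of_sets (f.measurable_degree.sub g.measurable_degree) (hf.sub hg)
    fun S hS => ?_
  refine le_trans (le_of_eq ?_) (le_cutDist f g hS MeasurableSet.univ)
  congr 1
  have h1 : IntegrableOn (fun z : I × I => f z.1 z.2 - g z.1 z.2) (S ×ˢ Set.univ)
      ((volume : Measure I).prod volume) := (integrable_diff f g).integrableOn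
  refine Eq.trans ?_ (setIntegral_prod _ h1).symm
  refine integral_congr_ae (ae_of_all _ fun x => ?_)
  have hint : ∀ h : Graphon, Integrable (fun y => h x y) := fun h =>
    Integrable.of_bound (h.measurable'.comp measurable_prodMk_left).aestronglyMeasurable 1
      (ae_of_all _ fun y => by
        have := h.mem_Icc' x y
        rw [Real.norm_eq_abs, abs_of_nonneg this.1]
        exact this.2)
  simp only [Pi.sub_apply, degree, Measure.restrict_univ]
  rw [integral_sub (hint f) (hint g)]

lemma degree_rearrange (f : Graphon) (φ : Rearrangement) (x : I) :
    (f.rearrange φ).degree x = f.degree (φ.1 x) :=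
  φ.2.integral_comp φ.1.measurableEmbedding (fun y => f (φ.1 x) y)

/-- The degree distribution only depends on the class of a graphon. -/
lemma integral_comp_degree_congr {f g : Graphon} (h : dist f g = 0) {Φ : ℝ → ℝ}
    (hΦ : LipschitzWith 1 Φ) : ∫ x, Φ (f.degree x) = ∫ x, Φ (g.degree x) := by
  -- The integral of `Φ` over the degrees is unchanged by rearranging `g`, so the `L¹` bound on
  -- degrees holds for every `φ` and passes to the infimum.
  have key : |(∫ x, Φ (f.degree x)) - ∫ x, Φ (g.degree x)| / 2 ≤ cutMetric f g := by
    refine le_ciInf fun φ => ?_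
    rw [div_le_iff₀ two_pos, mul_comm]
    refine le_trans ?_ (integral_abs_degree_sub_le f (g.rearrange φ))
    have h1 : ∫ x, Φ (g.degree x) = ∫ x, Φ ((g.rearrange φ).degree x) := by
      simp only [degree_rearrange]
      exact (φ.2.integral_comp φ.1.measurableEmbedding (fun x => Φ (g.degree x))).symm
    have hf := integrable_comp_degree hΦ.continuous f
    have hg := integrable_comp_degree hΦ.continuous (g.rearrange φ)
    have hf' := integrable_comp_degree continuous_id f
    have hg' := integrable_comp_degree continuous_id (g.rearrange φ)
    rw [h1, ← integral_sub hf hg]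
    refine abs_integral_le_integral_abs.trans ?_
    refine integral_mono (hf.sub hg).abs (hf'.sub hg').abs fun x => ?_
    have := hΦ.dist_le_mul (f.degree x) ((g.rearrange φ).degree x)
    simpa [Real.dist_eq] using this
  have h0 : cutMetric f g = 0 := h
  rw [h0] at key
  have : |(∫ x, Φ (f.degree x)) - ∫ x, Φ (g.degree x)| = 0 :=
    le_antisymm (by linarith) (abs_nonneg _)
  rw [abs_eq_zero] at this
  linarith

lemma cutDist_le_integral_abs (f g : Graphon) :
    cutDist f g ≤ ∫ z : I × I, |f z.1 z.2 - g z.1 z.2| := by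
  refine ciSup_le fun ST => ?_
  refine abs_integral_le_integral_abs.trans ?_
  exact setIntegral_le_integral (integrable_diff f g).abs (ae_of_all _ fun _ => abs_nonneg _)

/-! ### Graphons supported between a set and its complement -/

/-- The pairs with exactly one coordinate in `S`. -/
def cross (S : Set I) : Set (I × I) := S ×ˢ Sᶜ ∪ Sᶜ ×ˢ S

lemma mem_cross {S : Set I} {z : I × I} :
    z ∈ cross S ↔ z.1 ∈ S ∧ z.2 ∉ S ∨ z.1 ∉ S ∧ z.2 ∈ S := by
  simp [cross]

lemma notMem_cross_left {S : Set I} {x y : I} (hx : x ∈ S) (hy : y ∉ Sᶜ) : (x, y) ∉ cross S := by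
  rw [Set.notMem_compl_iff] at hy
  simp [mem_cross, hx, hy]

lemma notMem_cross_right {S : Set I} {x y : I} (hx : x ∈ Sᶜ) (hy : y ∉ S) : (x, y) ∉ cross S := by
  rw [Set.mem_compl_iff] at hx
  simp [mem_cross, hx, hy]

lemma cross_compl (S : Set I) : cross Sᶜ = cross S := by
  rw [cross, cross, compl_compl, Set.union_comm]

lemma measurableSet_cross {S : Set I} (hS : MeasurableSet S) : MeasurableSet (cross S) :=
  (hS.prod hS.compl).union (hS.compl.prod hS)

lemma setIntegral_cross {S : Set I} (hS : MeasurableSet S) {g : I × I → ℝ} (hg : Integrable g)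
    (hsymm : ∀ z, g z.swap = g z) : ∫ z in cross S, g z = 2 * ∫ z in S ×ˢ Sᶜ, g z := by
  have hd : Disjoint (S ×ˢ Sᶜ) (Sᶜ ×ˢ S) := by
    rw [Set.disjoint_left]
    rintro z ⟨h1, -⟩ ⟨h2, -⟩
    exact h2 h1
  rw [cross, setIntegral_union hd (hS.compl.prod hS) hg.integrableOn hg.integrableOn, two_mul]
  congr 1
  have hp : MeasurePreserving (MeasurableEquiv.prodComm (α := I) (β := I)) volume volume :=
    Measure.measurePreserving_swap
  have h := hp.setIntegral_preimage_emb (MeasurableEquiv.prodComm (α := I) (β := I)).measurableEmbedding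
    g (S ×ˢ Sᶜ)
  rw [← h]
  have hpre : (MeasurableEquiv.prodComm (α := I) (β := I)) ⁻¹' (S ×ˢ Sᶜ) = Sᶜ ×ˢ S := by
    ext z
    simp [MeasurableEquiv.prodComm]
  rw [hpre]
  exact integral_congr_ae (ae_of_all _ fun z => (hsymm z).symm)

lemma setIntegral_cross_of_fst {S : Set I} (hS : MeasurableSet S) {f : Graphon} {a : I → ℝ}
    (hf : ∀ x ∈ S, ∀ y ∉ S, f x y = a x) {φ : ℝ → ℝ} (hφ : Continuous φ) :
    ∫ z in cross S, φ (f z.1 z.2) = 2 * (volume.real Sᶜ * ∫ x in S, φ (a x)) := by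
  rw [setIntegral_cross hS (integrable_comp hφ f) fun z => by
    simp only [Prod.fst_swap, Prod.snd_swap, f.symm' z.2 z.1]]
  have h1 : ∫ z in S ×ˢ Sᶜ, φ (f z.1 z.2) = ∫ z in S ×ˢ Sᶜ, φ (a z.1) * 1 := by
    refine setIntegral_congr_fun (hS.prod hS.compl) fun z hz => ?_
    simp only [hf z.1 hz.1 z.2 hz.2, mul_one]
  rw [h1]
  have h2 := setIntegral_prod_mul (μ := (volume : Measure I)) (ν := (volume : Measure I))
    (fun x => φ (a x)) (fun _ => (1 : ℝ)) S Sᶜ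
  rw [setIntegral_const, smul_eq_mul, mul_one] at h2
  rw [mul_comm (volume.real Sᶜ), ← h2]
  rfl

lemma volume_real_cross {S : Set I} (hS : MeasurableSet S) :
    volume.real (cross S) = 2 * (volume.real S * volume.real Sᶜ) := by
  have hd : Disjoint (S ×ˢ Sᶜ) (Sᶜ ×ˢ S) := by
    rw [Set.disjoint_left]
    rintro z ⟨h1, -⟩ ⟨h2, -⟩
    exact h2 h1
  rw [cross, measureReal_union hd (hS.compl.prod hS)]
  have h := fun A B : Set I => measureReal_prod_prod (μ := (volume : Measure I))
    (ν := (volume : Measure I)) A B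
  have e : (volume : Measure (I × I)) = (volume : Measure I).prod volume := rfl
  rw [e, h, h]
  ring

/-- Testing the kernel operator with the indicator of `Sᶜ`. -/
lemma sqrt_le_opNorm_of_fst {S : Set I} (hS : MeasurableSet S) (hv : 0 < volume.real Sᶜ)
    {f : Graphon} {a : I → ℝ} (hf : ∀ x ∈ S, ∀ y ∉ S, f x y = a x) :
    √(volume.real Sᶜ * ∫ x in S, a x ^ 2) ≤ f.opNorm := by
  refine le_csInf f.opBounds_nonempty fun c hc => ?_
  set u : I → ℝ := Sᶜ.indicator 1 with hu
  have hm : Measurable u := measurable_one.indicator hS.compl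
  have hL : MemLp u 2 volume := (memLp_const (1 : ℝ)).indicator hS.compl
  have h := integral_kernelOp_sq_le hc hm hL
  have h1 : ∫ x, u x ^ 2 = volume.real Sᶜ := by
    have : (fun x => u x ^ 2) = Sᶜ.indicator 1 := by
      ext x
      by_cases hx : x ∈ Sᶜ <;> simp [hu, hx]
    rw [this, integral_indicator_one hS.compl]
  have h2 : ∫ x in S, f.kernelOp u x ^ 2 ≤ ∫ x, f.kernelOp u x ^ 2 :=
    setIntegral_le_integral (f.memLp_kernelOp hm hL).integrable_sq (ae_of_all _ fun _ => sq_nonneg _)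
  have h3 : ∫ x in S, f.kernelOp u x ^ 2 = volume.real Sᶜ ^ 2 * ∫ x in S, a x ^ 2 := by
    rw [← integral_const_mul]
    refine setIntegral_congr_fun hS fun x hx => ?_
    have : f.kernelOp u x = volume.real Sᶜ * a x := by
      have h4 : (fun y => f x y * u y) = Sᶜ.indicator fun _ => a x := by
        ext y
        by_cases hy : y ∈ S
        · simp [hu, hy]
        · simp [hu, hy, hf x hx y hy]
      rw [kernelOp, h4, integral_indicator hS.compl, setIntegral_const, smul_eq_mul]
    simp only [this, mul_pow]
  rw [Real.sqrt_le_left hc.1]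
  rw [h1] at h
  nlinarith

/-- For a kernel supported on `S × Sᶜ ∪ Sᶜ × S` the squared operator norm is at most half the squared
Hilbert-Schmidt norm. -/
lemma opNorm_sq_le_of_cross {S : Set I} (hS : MeasurableSet S) {f : Graphon}
    (hf : ∀ᵐ z : I × I, z ∉ cross S → f z.1 z.2 = 0) :
    f.opNorm ^ 2 ≤ (∫ z in cross S, f z.1 z.2 ^ 2) / 2 := by
  set Q := (∫ z in cross S, f z.1 z.2 ^ 2) / 2 with hQ
  have hQ0 : 0 ≤ Q := div_nonneg (integral_nonneg fun z => sq_nonneg _) two_pos.le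
  have hsq : Integrable fun z : I × I => f z.1 z.2 ^ 2 :=
    integrable_comp (φ := fun u => u ^ 2) (by fun_prop) f
  have hrow : ∀ x, MemLp (f x) 2 volume := fun x =>
    MemLp.of_bound (f.measurable'.comp measurable_prodMk_left).aestronglyMeasurable 1
      (ae_of_all _ fun y => by
        have := f.mem_Icc' x y
        rw [Real.norm_eq_abs, abs_of_nonneg this.1]
        exact this.2)
  have hae : ∀ᵐ x : I, ∀ᵐ y : I, (x, y) ∉ cross S → f x y = 0 := Measure.ae_ae_of_ae_prod hf
  set q : I → ℝ := fun x => ∫ y, f x y ^ 2 with hq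
  have hqi : Integrable q := hsq.integral_prod_left
  have hq0 : ∀ x, 0 ≤ q x := fun x => integral_nonneg fun y => sq_nonneg _
  have half : ∀ A B : Set I, MeasurableSet A → B = Aᶜ →
      (∀ x y, x ∈ A → y ∉ B → (x, y) ∉ cross S) → ∫ z in A ×ˢ B, f z.1 z.2 ^ 2 = ∫ x in A, q x := by
    intro A B hA hB hAB
    have h1 : IntegrableOn (fun z : I × I => f z.1 z.2 ^ 2) (A ×ˢ B)
      ((volume : Measure I).prod volume) := hsq.integrableOn
    refine (setIntegral_prod _ h1).trans (setIntegral_congr_ae hA ?_)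
    filter_upwards [hae] with x hx hxA
    refine setIntegral_eq_integral_of_ae_compl_eq_zero ?_
    filter_upwards [hx] with y hy hyB
    simp [hy (hAB x y hxA hyB)]
  have hS1 : ∫ x in S, q x = Q := by
    rw [← half S Sᶜ hS rfl fun x y hx hy => notMem_cross_left hx hy, hQ,
      setIntegral_cross hS hsq fun z => by
        simp only [Prod.fst_swap, Prod.snd_swap, f.symm' z.2 z.1]]
    ring
  have hS2 : ∫ x in Sᶜ, q x = Q := by
    rw [← half Sᶜ S hS.compl (compl_compl S).symm fun x y hx hy => notMem_cross_right hx hy, hQ, ← cross_compl,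
      setIntegral_cross hS.compl hsq fun z => by
        simp only [Prod.fst_swap, Prod.snd_swap, f.symm' z.2 z.1], compl_compl]
    ring
  have hmem : √Q ∈ f.opBounds := by
    refine mem_opBounds_of_sq (Real.sqrt_nonneg _) fun u hm hu => ?_
    rw [Real.sq_sqrt hQ0]
    have hui : Integrable fun x => u x ^ 2 := hu.integrable_sq
    -- For a row supported in `B`, Cauchy–Schwarz sees only the mass of `u` on `B`. Rows over `S`
    -- use `u` on `Sᶜ` and conversely; both halves of the kernel have the same mass `Q` by symmetry,
    -- so the total is `Q ∫ u²` rather than `2Q ∫ u²`.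
    have cs : ∀ B : Set I, MeasurableSet B → ∀ x, (∀ᵐ y, y ∉ B → f x y = 0) →
        f.kernelOp u x ^ 2 ≤ q x * ∫ y in B, u y ^ 2 := by
      intro B hB x hx
      have h1 : f.kernelOp u x = ∫ y, f x y * B.indicator u y := by
        refine integral_congr_ae ?_
        filter_upwards [hx] with y hy
        by_cases hyB : y ∈ B
        · simp [hyB]
        · simp [hy hyB]
      have h2 : |f.kernelOp u x| ≤ √(q x) * √(∫ y in B, u y ^ 2) := by
        rw [h1]
        refine abs_integral_le_integral_abs.trans ?_
        simp only [abs_mul]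
        refine (integral_abs_mul_le_sqrt (hrow x) (hu.indicator hB)).trans (le_of_eq ?_)
        congr 2
        rw [← integral_indicator hB]
        refine integral_congr_ae (ae_of_all _ fun y => ?_)
        by_cases hyB : y ∈ B <;> simp [hyB]
      rw [← sq_abs]
      refine (pow_le_pow_left₀ (abs_nonneg _) h2 2).trans (le_of_eq ?_)
      rw [mul_pow, Real.sq_sqrt (hq0 x), Real.sq_sqrt (integral_nonneg fun y => sq_nonneg _)]
    have hki : Integrable fun x => f.kernelOp u x ^ 2 := (f.memLp_kernelOp hm hu).integrable_sq
    have b1 : ∫ x in S, f.kernelOp u x ^ 2 ≤ Q * ∫ y in Sᶜ, u y ^ 2 := by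
      rw [← hS1, ← integral_mul_const]
      refine setIntegral_mono_on_ae hki.integrableOn (hqi.mul_const _).integrableOn hS ?_
      filter_upwards [hae] with x hx hxS
      refine cs Sᶜ hS.compl x ?_
      filter_upwards [hx] with y hy hyS
      exact hy (notMem_cross_left hxS hyS)
    have b2 : ∫ x in Sᶜ, f.kernelOp u x ^ 2 ≤ Q * ∫ y in S, u y ^ 2 := by
      rw [← hS2, ← integral_mul_const]
      refine setIntegral_mono_on_ae hki.integrableOn (hqi.mul_const _).integrableOn hS.compl ?_
      filter_upwards [hae] with x hx hxS
      refine cs S hS x ?_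
      filter_upwards [hx] with y hy hyS
      exact hy (notMem_cross_right hxS hyS)
    rw [← integral_add_compl hS hki, ← integral_add_compl hS hui]
    linarith
  rw [← Real.sq_sqrt hQ0]
  exact pow_le_pow_left₀ f.opNorm_nonneg (csInf_le f.bddBelow_opBounds hmem) 2

end Graphon

namespace Graphon

/-! ### The bipartite graphon and its relative entropy -/

/-- The interval `[0, γ]`. -/
def lowSet (γ : ℝ) : Set I := {x | (x : ℝ) ≤ γ}

lemma measurableSet_lowSet (γ : ℝ) : MeasurableSet (lowSet γ) :=
  measurableSet_le measurable_subtype_coe measurable_const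

lemma volume_real_lowSet {γ : ℝ} (h0 : 0 ≤ γ) (h1 : γ ≤ 1) : volume.real (lowSet γ) = γ := by
  have : lowSet γ = Set.Iic (⟨γ, h0, h1⟩ : I) := by
    ext x
    exact Iff.rfl
  rw [this, Measure.real, unitInterval.volume_Iic, ENNReal.toReal_ofReal h0]

lemma volume_real_compl {S : Set I} (hS : MeasurableSet S) :
    volume.real Sᶜ = 1 - volume.real S := by
  rw [measureReal_compl hS, probReal_univ]

lemma bipartite_of_mem_cross {γ p : ℝ} (hp : p ∈ Set.Icc (0 : ℝ) 1) {x y : I}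
    (h : (x, y) ∈ cross (lowSet γ)) : bipartite γ p hp x y = p := by
  simp only [mem_cross, lowSet, Set.mem_ofPred_eq, not_le] at h
  simp only [bipartite]
  rw [if_neg]
  rintro (h1 | h1) <;> rcases h with h | h <;> linarith [h.1, h.2, h1.1, h1.2]

lemma bipartite_of_notMem_cross {γ p : ℝ} (hp : p ∈ Set.Icc (0 : ℝ) 1) {x y : I}
    (h : (x, y) ∉ cross (lowSet γ)) : bipartite γ p hp x y = 0 := by
  simp only [mem_cross, lowSet, Set.mem_ofPred_eq, not_le] at h
  simp only [bipartite]
  rw [if_pos]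
  by_contra! h1
  refine h ?_
  rcases le_or_gt (x : ℝ) γ with hx | hx
  · exact Or.inl ⟨hx, h1.1 hx⟩
  · exact Or.inr ⟨hx, h1.2 hx⟩

lemma extRelEntropy_eq_ofReal {p : ℝ} (hp0 : 0 < p) (hp1 : p < 1) (u : ℝ) :
    extRelEntropy p u = ENNReal.ofReal (relEntropy p u) := by
  rw [extRelEntropy, if_neg]
  rintro (h | h)
  · exact hp0.ne' h.1
  · exact hp1.ne h.1

lemma extRelEntropy_zero_zero : extRelEntropy 0 0 = 0 := by
  simp [extRelEntropy, relEntropy]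

lemma setLIntegral_cross_extRelEntropy {γ p : ℝ} (hp0 : 0 < p) (hp1 : p < 1) (hp : p ∈ Set.Icc (0 : ℝ) 1) (f : Graphon) :
    ∫⁻ z in cross (lowSet γ), extRelEntropy (bipartite γ p hp z.1 z.2) (f z.1 z.2) =
      ENNReal.ofReal (∫ z in cross (lowSet γ), relEntropy p (f z.1 z.2)) := by
  rw [ofReal_integral_eq_lintegral_ofReal
    (integrable_comp (continuous_relEntropy hp0 hp1) f).integrableOn
    (ae_of_all _ fun z => relEntropy_nonneg hp0 hp1 (f.mem_Icc' _ _))]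
  refine setLIntegral_congr_fun (measurableSet_cross (measurableSet_lowSet γ)) fun z hz => ?_
  simp only [bipartite_of_mem_cross _ hz, extRelEntropy_eq_ofReal hp0 hp1]

lemma entropy_bipartite_eq {γ p : ℝ} (hp0 : 0 < p) (hp1 : p < 1) (hp : p ∈ Set.Icc (0 : ℝ) 1) {f : Graphon}
    (hf : ∀ x y, (x, y) ∉ cross (lowSet γ) → f x y = 0) :
    (bipartite γ p hp).entropy f =
      ENNReal.ofReal ((∫ z in cross (lowSet γ), relEntropy p (f z.1 z.2)) / 2) := by
  have hm := measurableSet_cross (measurableSet_lowSet γ)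
  rw [entropy, ← lintegral_add_compl _ hm, setLIntegral_cross_extRelEntropy hp0 hp1 hp,
    setLIntegral_congr_fun (g := fun _ => 0) hm.compl fun z hz => by
      simp only [bipartite_of_notMem_cross _ hz, hf z.1 z.2 hz, extRelEntropy_zero_zero],
    lintegral_zero, add_zero, ENNReal.ofReal_div_of_pos two_pos]
  simp

/-- Off the cross the reference value is `0`, where `h_0(u) = ∞` for `u ≠ 0`, so finite entropy
forces `f = 0` almost everywhere there. On the cross the entropy is a real integral. -/
lemma entropy_bipartite_le_ofReal {γ p K : ℝ} (hp0 : 0 < p) (hp1 : p < 1) (hp : p ∈ Set.Icc (0 : ℝ) 1) (hK : 0 ≤ K)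
    {f : Graphon} (h : (bipartite γ p hp).entropy f ≤ ENNReal.ofReal K) :
    (∀ᵐ z : I × I, z ∉ cross (lowSet γ) → f z.1 z.2 = 0) ∧
      ∫ z in cross (lowSet γ), relEntropy p (f z.1 z.2) ≤ 2 * K := by
  have hm := measurableSet_cross (measurableSet_lowSet γ)
  set F : I × I → ℝ≥0∞ := fun z =>
    extRelEntropy (bipartite γ p hp z.1 z.2) (f z.1 z.2) with hF
  have hle : ∫⁻ z, F z ≤ ENNReal.ofReal (2 * K) := by
    rw [entropy, ENNReal.div_le_iff (by simp) (by simp)] at h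
    refine h.trans (le_of_eq ?_)
    rw [mul_comm 2 K, ENNReal.ofReal_mul hK]
    simp
  constructor
  · have hN : MeasurableSet {z : I × I | ¬ (z ∉ cross (lowSet γ) → f z.1 z.2 = 0)} := by
      have : {z : I × I | ¬ (z ∉ cross (lowSet γ) → f z.1 z.2 = 0)} =
          (cross (lowSet γ))ᶜ ∩ {z | f z.1 z.2 = 0}ᶜ := by
        ext z
        simp
      rw [this]
      exact hm.compl.inter (measurableSet_eq_fun f.measurable' measurable_const).compl
    rw [ae_iff]
    by_contra hne
    have h1 : ∫⁻ z in {z : I × I | ¬ (z ∉ cross (lowSet γ) → f z.1 z.2 = 0)}, F z = ⊤ := by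
      rw [setLIntegral_congr_fun (g := fun _ => ⊤) hN fun z hz => by
        rw [Set.mem_ofPred_eq, Classical.not_imp] at hz
        simp only [hF, bipartite_of_notMem_cross _ hz.1, extRelEntropy]
        rw [if_pos (Or.inl ⟨trivial, hz.2⟩)], setLIntegral_const, ENNReal.top_mul hne]
    have h2 := h1.symm.trans_le ((setLIntegral_le_lintegral _ F).trans hle)
    exact ENNReal.ofReal_ne_top (top_le_iff.1 h2)
  · have h2 := (setLIntegral_le_lintegral (cross (lowSet γ)) F).trans hle
    rw [hF, setLIntegral_cross_extRelEntropy hp0 hp1 hp, ENNReal.ofReal_le_ofReal_iff (by linarith)]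
      at h2
    exact h2

lemma mem_agreeing_bipartite {γ p : ℝ} (hp0 : 0 < p) (hp1 : p < 1) (hp : p ∈ Set.Icc (0 : ℝ) 1) {f : Graphon}
    (hf : ∀ x y, (x, y) ∉ cross (lowSet γ) → f x y = 0) :
    f ∈ (bipartite γ p hp).agreeing := by
  have : {z : I × I | z ∈ (bipartite γ p hp).omegaᶜ ∧
      f z.1 z.2 ≠ bipartite γ p hp z.1 z.2} = ∅ := by
    rw [Set.eq_empty_iff_forall_notMem]
    rintro z ⟨hz, hne⟩
    by_cases hc : (z.1, z.2) ∈ cross (lowSet γ)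
    · refine hz ?_
      simp only [omega, Set.mem_ofPred_eq, bipartite_of_mem_cross _ hc]
      exact ⟨hp0, hp1⟩
    · exact hne (by rw [hf _ _ hc, bipartite_of_notMem_cross _ hc])
  rw [agreeing, Set.mem_ofPred_eq, this, measure_empty]

lemma rate_toClass_le {W₀ f : Graphon} (hf : f ∈ W₀.agreeing) :
    W₀.rate f.toClass ≤ W₀.entropy f := by
  rw [rate, if_pos ⟨f, hf, dist_self _⟩]
  exact iSup₂_le fun η hη => iInf₂_le f (by rw [dist_self]; exact hη.le)

lemma dist_toClass (f g : Graphon) : dist f.toClass g.toClass = dist f g :=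
  SeparationQuotient.dist_mk f g

/-- The operator norm is at most `t_max` on the classes that agree with `W₀`. -/
lemma opNorm_le_tMax {W₀ f : Graphon} (hf : f ∈ W₀.agreeing) :
    f.opNorm ≤ W₀.tMax GraphonSpace.opNorm := by
  refine le_csSup ⟨√(2 * √(2 * 1)), ?_⟩ ⟨f.toClass, ⟨f, hf, dist_self _⟩, rfl⟩
  rintro _ ⟨F, -, rfl⟩
  obtain ⟨g, rfl⟩ := SeparationQuotient.surjective_mk F
  exact opNorm_le_const g

/-- The rate of `F` is an envelope, so a representative of `F` need not itself have the right
entropy. It is replaced by a nearby graphon whose operator norm is almost as large, by continuity of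
the norm in the cut metric. -/
lemma exists_near_of_rate_le {W₀ : Graphon} {F : GraphonSpace} {K t : ℝ} (hK : 0 ≤ K)
    (hF : W₀.rate F ≤ ENNReal.ofReal K) (ht : t ≤ F.opNorm) {δ : ℝ} (hδ : 0 < δ) :
    ∃ h : Graphon, dist F h.toClass ≤ δ ∧ t - δ ≤ h.opNorm ∧
      W₀.entropy h ≤ ENNReal.ofReal (K + δ) := by
  -- The modulus is evaluated at `2 * s` because `opNorm_le_add_of_dist_lt` needs a strict
  -- inequality, while the envelope gives only `dist ≤ η`.
  have hcont : Continuous fun s : ℝ => √(2 * √(2 * (2 * s))) := by fun_prop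
  have hev : ∀ᶠ s in nhds (0 : ℝ), √(2 * √(2 * (2 * s))) < δ :=
    hcont.continuousAt.eventually_lt_const (by simpa using hδ)
  obtain ⟨η', hη', hb⟩ := Metric.eventually_nhds_iff.1 hev
  set η := min (η' / 2) δ with hη
  have hη0 : 0 < η := lt_min (by linarith) hδ
  have hηb := hb (y := η) (by
    rw [Real.dist_eq, sub_zero, abs_of_pos hη0]
    linarith [min_le_left (η' / 2) δ])
  have hmem : F ∈ W₀.agreeingClasses := by
    by_contra hn
    rw [rate, if_neg hn, top_le_iff] at hF
    exact ENNReal.ofReal_ne_top hF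
  rw [rate, if_pos hmem] at hF
  have h1 := (le_iSup₂ (f := fun (η : ℝ) (_ : 0 < η) =>
    ⨅ (h : Graphon) (_ : dist F h.toClass ≤ η), W₀.entropy h) η hη0).trans hF
  have h2 := h1.trans_lt ((ENNReal.ofReal_lt_ofReal_iff (by linarith)).2
    (show K < K + δ by linarith))
  simp only [iInf_lt_iff] at h2
  obtain ⟨h, hd, he⟩ := h2
  refine ⟨h, hd.trans (min_le_right _ _), ?_, he.le⟩
  obtain ⟨g, rfl⟩ := SeparationQuotient.surjective_mk F
  rw [dist_toClass] at hd
  have h3 := opNorm_le_add_of_dist_lt (f := g) (g := h) (η := 2 * η) (by linarith)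
  have h4 : t ≤ g.opNorm := ht
  linarith

lemma volume_real_cross_lowSet {γ : ℝ} (h0 : 0 < γ) (h1 : γ < 1) :
    volume.real (cross (lowSet γ)) = 2 * (γ * (1 - γ)) := by
  rw [volume_real_cross (measurableSet_lowSet γ), volume_real_compl (measurableSet_lowSet γ),
    volume_real_lowSet h0.le h1.le]

/-- The Hilbert–Schmidt bound from above and the indicator of a block from below agree, since the
operator between the blocks has rank one. -/
lemma opNorm_bipartite {γ r : ℝ} (h0 : 0 < γ) (h1 : γ < 1) (hr : r ∈ Set.Icc (0 : ℝ) 1) :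
    (bipartite γ r hr).opNorm = √(γ * (1 - γ) * r ^ 2) := by
  have hm := measurableSet_lowSet γ
  have hc := volume_real_compl hm
  rw [volume_real_lowSet h0.le h1.le] at hc
  refine le_antisymm ?_ ?_
  · refine Real.le_sqrt_of_sq_le ?_
    refine (opNorm_sq_le_of_cross hm
      (ae_of_all _ fun z hz => bipartite_of_notMem_cross hr hz)).trans (le_of_eq ?_)
    rw [setIntegral_congr_fun (g := fun _ => r ^ 2) (measurableSet_cross hm) fun z hz => by
      simp only [bipartite_of_mem_cross hr hz], setIntegral_const, smul_eq_mul,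
      volume_real_cross_lowSet h0 h1]
    ring
  · have h := sqrt_le_opNorm_of_fst hm (by rw [hc]; linarith) (f := bipartite γ r hr)
      (a := fun _ => r) fun x hx y hy => bipartite_of_mem_cross hr (mem_cross.2 (Or.inl ⟨hx, hy⟩))
    rw [setIntegral_const, smul_eq_mul, hc, volume_real_lowSet h0.le h1.le] at h
    refine le_trans (le_of_eq ?_) h
    congr 1
    ring

/-- A lower bound on the second moment of a graphon of finite entropy from its operator norm. -/
lemma setIntegral_sq_sub_ge {γ r δ : ℝ} (h0 : 0 < γ) (h1 : γ < 1) (hr : r ∈ Set.Icc (0 : ℝ) 1)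
    (hδ : 0 < δ) {f : Graphon} (hf : ∀ᵐ z : I × I, z ∉ cross (lowSet γ) → f z.1 z.2 = 0)
    (hop : √(γ * (1 - γ) * r ^ 2) - δ ≤ f.opNorm) :
    -(4 * δ) ≤ ∫ z in cross (lowSet γ), (f z.1 z.2 ^ 2 - r ^ 2) := by
  have hm := measurableSet_lowSet γ
  have hsq : Integrable fun z : I × I => f z.1 z.2 ^ 2 :=
    integrable_comp (φ := fun u => u ^ 2) (by fun_prop) f
  rw [integral_sub hsq.integrableOn (integrable_const _).integrableOn, setIntegral_const,
    smul_eq_mul, volume_real_cross_lowSet h0 h1]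
  have h2 := opNorm_sq_le_of_cross hm hf
  have hγ : 0 ≤ γ * (1 - γ) := mul_nonneg h0.le (by linarith)
  have hq0 : 0 ≤ γ * (1 - γ) * r ^ 2 := by positivity
  have hq1 : γ * (1 - γ) * r ^ 2 ≤ 1 := by
    have : r ^ 2 ≤ 1 := by nlinarith [hr.1, hr.2]
    nlinarith
  set t := √(γ * (1 - γ) * r ^ 2) with ht
  have ht0 : 0 ≤ t := Real.sqrt_nonneg _
  have ht1 : t ≤ 1 := Real.sqrt_le_one.2 hq1
  have ht2 : t ^ 2 = γ * (1 - γ) * r ^ 2 := Real.sq_sqrt hq0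
  -- Squaring loses at most `2δ` since `t ≤ 1`. Doubling, from the half in the Hilbert–Schmidt
  -- bound, gives the `4δ` of the conclusion.
  have h3 : t ^ 2 - 2 * δ ≤ f.opNorm ^ 2 := by
    have := f.opNorm_nonneg
    rcases le_or_gt t f.opNorm with h | h <;> nlinarith
  linarith

/-! ### The regime of the convex minorant -/

/-- Stability at the optimum: near-optimal graphons approximating `F` are also close to `f_r^γ`,
within an arbitrary `e`. Assuming only a bound on the rate, not minimality, lets the same statement
show that `f_r^γ` is itself a minimizer. -/
lemma toClass_eq_of_rate_le {p r γ : ℝ} (hp0 : 0 < p) (hp1 : p < 1) (hp : p ∈ Set.Icc (0 : ℝ) 1) (hpr : p ≤ r) (hr1 : r ≤ 1) (hr : r ∈ Set.Icc (0 : ℝ) 1)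
    (hγ0 : 0 < γ) (hγ1 : γ < 1)
    (h : OnConvexMinorant (Set.Icc 0 1) (fun x => relEntropy p (√x)) (r ^ 2) (relEntropy p r))
    {F : GraphonSpace}
    (hF : (bipartite γ p hp).rate F ≤ ENNReal.ofReal (γ * (1 - γ) * relEntropy p r))
    (ht : (bipartite γ r hr).opNorm ≤ F.opNorm) :
    F = (bipartite γ r hr).toClass := by
  have hm := measurableSet_lowSet γ
  have hmc := measurableSet_cross hm
  rw [opNorm_bipartite hγ0 hγ1 hr] at ht
  set fr := bipartite γ r hr with hfr
  refine dist_le_zero.1 (le_of_forall_pos_le_add fun e he => ?_)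
  rw [zero_add]
  -- The factor `p` compensates for the division in `p |f - r| ≤ |f² - r²|`. The cross has area at
  -- most `1/2`, so `ε` contributes `ep/4`, and `δ` is chosen to contribute at most `ep/4` more.
  obtain ⟨A, B, hA, hB, hAB⟩ := exists_deviation_bound hp0 hp1 hpr hr1 h
    (ε := e * p / 2) (by positivity)
  have hm0 : 0 ≤ γ * (1 - γ) := mul_nonneg hγ0.le (by linarith)
  have hm1 : 2 * (γ * (1 - γ)) ≤ 1 / 2 := by nlinarith [sq_nonneg (2 * γ - 1)]
  have hent0 := relEntropy_nonneg hp0 hp1 hr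
  set δ := min (e / 4) (e * p / (4 * (2 * A + 4 * B + 1))) with hδ
  have hδ0 : 0 < δ := by positivity
  obtain ⟨f, hd, hop, hent⟩ := exists_near_of_rate_le (by positivity) hF ht hδ0
  obtain ⟨hae, hE⟩ := entropy_bipartite_le_ofReal hp0 hp1 hp (by positivity) hent
  have hsqd := setIntegral_sq_sub_ge hγ0 hγ1 hr hδ0 hae hop
  have hfi := integrable_comp (φ := fun u => u ^ 2 - r ^ 2) (by fun_prop) f
  have hei := integrable_comp (φ := fun u => relEntropy p u - relEntropy p r)
    ((continuous_relEntropy hp0 hp1).sub continuous_const) f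
  have hei' := integrable_comp (continuous_relEntropy hp0 hp1) f
  have hE' : ∫ z in cross (lowSet γ), (relEntropy p (f z.1 z.2) - relEntropy p r) ≤ 2 * δ := by
    rw [integral_sub hei'.integrableOn (integrable_const _).integrableOn, setIntegral_const,
      smul_eq_mul, volume_real_cross_lowSet hγ0 hγ1]
    linarith
  have hdev : ∫ z in cross (lowSet γ), |f z.1 z.2 ^ 2 - r ^ 2| ≤
      e * p / 2 / 2 + A * (2 * δ) + B * (4 * δ) := by
    calc ∫ z in cross (lowSet γ), |f z.1 z.2 ^ 2 - r ^ 2|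
        ≤ ∫ z in cross (lowSet γ), (e * p / 2 + A * (relEntropy p (f z.1 z.2) - relEntropy p r) -
            B * (f z.1 z.2 ^ 2 - r ^ 2)) := by
          refine setIntegral_mono_on hfi.abs.integrableOn
            ((((integrable_const _).add (hei.const_mul A)).sub (hfi.const_mul B))).integrableOn
            hmc fun z _ => hAB _ (f.mem_Icc' _ _)
      _ = e * p / 2 * (2 * (γ * (1 - γ))) +
          A * (∫ z in cross (lowSet γ), (relEntropy p (f z.1 z.2) - relEntropy p r)) -
          B * ∫ z in cross (lowSet γ), (f z.1 z.2 ^ 2 - r ^ 2) := by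
          have hadd : Integrable fun z : I × I =>
              e * p / 2 + A * (relEntropy p (f z.1 z.2) - relEntropy p r) :=
            (integrable_const _).add (hei.const_mul A)
          rw [integral_sub hadd.integrableOn (hfi.const_mul B).integrableOn, integral_add (integrable_const _).integrableOn
            (hei.const_mul A).integrableOn, integral_const_mul, integral_const_mul,
            setIntegral_const, smul_eq_mul, volume_real_cross_lowSet hγ0 hγ1]
          ring
      _ ≤ e * p / 2 / 2 + A * (2 * δ) + B * (4 * δ) := by
          have h1 : e * p / 2 * (2 * (γ * (1 - γ))) ≤ e * p / 2 * (1 / 2) := by gcongr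
          have h2 := mul_le_mul_of_nonneg_left hE' hA
          have h3 := mul_le_mul_of_nonneg_left hsqd hB
          linarith
  have hL1 : cutDist f fr ≤ (∫ z in cross (lowSet γ), |f z.1 z.2 ^ 2 - r ^ 2|) / p := by
    refine (cutDist_le_integral_abs f fr).trans ?_
    rw [← setIntegral_eq_integral_of_ae_compl_eq_zero (s := cross (lowSet γ)) (by
      filter_upwards [hae] with z hz hzc
      rw [hz hzc, hfr, bipartite_of_notMem_cross hr hzc]
      simp), le_div_iff₀ hp0, ← integral_mul_const]
    refine setIntegral_mono_on ((integrable_diff f fr).abs.mul_const p).integrableOn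
      hfi.abs.integrableOn hmc fun z hz => ?_
    have h1 : fr z.1 z.2 = r := bipartite_of_mem_cross hr hz
    have h2 := f.mem_Icc' z.1 z.2
    rw [h1, show f z.1 z.2 ^ 2 - r ^ 2 = (f z.1 z.2 - r) * (f z.1 z.2 + r) by ring, abs_mul]
    refine mul_le_mul_of_nonneg_left ?_ (abs_nonneg _)
    refine le_trans ?_ (le_abs_self _)
    linarith [h2.1]
  have hδ1 : δ ≤ e / 4 := min_le_left _ _
  have hδ2 : (2 * A + 4 * B + 1) * δ ≤ e * p / 4 := by
    have h1 : δ ≤ e * p / (4 * (2 * A + 4 * B + 1)) := min_le_right _ _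
    rw [le_div_iff₀ (by positivity)] at h1
    linarith
  have hcut : cutDist f fr ≤ e / 2 := by
    refine hL1.trans ?_
    rw [div_le_iff₀ hp0]
    linarith
  have hdist : dist f.toClass fr.toClass ≤ e / 2 := by
    rw [dist_toClass]
    exact (cutMetric_le f fr ⟨MeasurableEquiv.refl I, MeasurePreserving.id _⟩).trans hcut
  have := dist_triangle F f.toClass fr.toClass
  linarith

/-! ### Block graphons with two blocks -/

lemma blockInterval_zero (γ : ℝ) : blockInterval ![γ, 1 - γ] 0 = lowSet γ := by
  have h1 : Finset.univ.filter (· < (0 : Fin 2)) = ∅ := by decide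
  have h2 : Finset.univ.filter (· ≤ (0 : Fin 2)) = {0} := by decide
  ext x
  rw [blockInterval, h1, h2]
  simp only [Finset.sum_empty, Finset.sum_singleton, Matrix.cons_val_zero, lowSet,
    Set.mem_ofPred_eq, and_iff_right_iff_imp]
  intro _
  rcases x.2.1.lt_or_eq with h | h
  · exact Or.inl h
  · exact Or.inr ⟨rfl, h.symm⟩

lemma blockInterval_one (γ : ℝ) : blockInterval ![γ, 1 - γ] 1 = (lowSet γ)ᶜ := by
  have h1 : Finset.univ.filter (· < (1 : Fin 2)) = {0} := by decide
  have h2 : Finset.univ.filter (· ≤ (1 : Fin 2)) = Finset.univ := by decide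
  ext x
  rw [blockInterval, h1, h2]
  have h3 : (x : ℝ) ≤ 1 := x.2.2
  simp [lowSet, h3]

lemma bipartite_mem_blockGraphons {γ r : ℝ} (hr : r ∈ Set.Icc (0 : ℝ) 1) :
    bipartite γ r hr ∈ blockGraphons ![γ, 1 - γ] := by
  refine ⟨!![0, r; r, 0], ?_, ?_, ?_⟩
  · intro i j
    fin_cases i <;> fin_cases j <;> simp [hr.1, hr.2]
  · intro i j
    fin_cases i <;> fin_cases j <;> simp
  · intro i j x hx y hy
    fin_cases i <;> fin_cases j <;>
      simp only [Fin.zero_eta, Fin.mk_one, blockInterval_zero, blockInterval_one] at hx hy ⊢ <;>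
      first
      | exact bipartite_of_notMem_cross hr (by simp_all [mem_cross])
      | exact bipartite_of_mem_cross hr (by simp_all [mem_cross])

/-! ### Off the convex minorant -/

/-- Integrating the parabola over the cross leaves `k` times its area plus `c ≥ 0` times the excess
second moment, which is almost nonnegative for the approximating graphons. -/
lemma ofReal_le_rate {p r γ k c : ℝ} (hp0 : 0 < p) (hp1 : p < 1) (hp : p ∈ Set.Icc (0 : ℝ) 1) (hr : r ∈ Set.Icc (0 : ℝ) 1)
    (hγ0 : 0 < γ) (hγ1 : γ < 1) (hc : 0 ≤ c)
    (hk : ∀ u ∈ Set.Icc (0 : ℝ) 1, k + c * (u ^ 2 - r ^ 2) ≤ relEntropy p u) {F : GraphonSpace}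
    (ht : (bipartite γ r hr).opNorm ≤ F.opNorm) :
    ENNReal.ofReal (γ * (1 - γ) * k) ≤ (bipartite γ p hp).rate F := by
  rw [opNorm_bipartite hγ0 hγ1 hr] at ht
  by_contra! hlt
  obtain ⟨K, hK0, hK, hKlt⟩ : ∃ K : ℝ, 0 ≤ K ∧
      (bipartite γ p hp).rate F ≤ ENNReal.ofReal K ∧ K < γ * (1 - γ) * k := by
    have hne := (hlt.trans ENNReal.ofReal_lt_top).ne
    refine ⟨_, ENNReal.toReal_nonneg, (ENNReal.ofReal_toReal hne).ge, ?_⟩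
    exact (ENNReal.lt_ofReal_iff_toReal_lt hne).1 hlt
  -- The approximation costs `δ` in entropy and `2cδ` through the second moment. This `δ` makes the
  -- total half of the assumed gap.
  set δ := (γ * (1 - γ) * k - K) / (2 * (1 + 2 * c)) with hδ
  have hδ0 : 0 < δ := div_pos (by linarith) (by positivity)
  obtain ⟨f, hd, hop, hent⟩ := exists_near_of_rate_le hK0 hK ht hδ0
  obtain ⟨hae, hE⟩ := entropy_bipartite_le_ofReal hp0 hp1 hp (by positivity) hent
  have hsqd := setIntegral_sq_sub_ge hγ0 hγ1 hr hδ0 hae hop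
  have hfi := integrable_comp (φ := fun u => u ^ 2 - r ^ 2) (by fun_prop) f
  have hei := integrable_comp (continuous_relEntropy hp0 hp1) f
  have h1 : ∫ z in cross (lowSet γ), (k + c * (f z.1 z.2 ^ 2 - r ^ 2)) ≤
      ∫ z in cross (lowSet γ), relEntropy p (f z.1 z.2) :=
    setIntegral_mono_on ((integrable_const k).add (hfi.const_mul c)).integrableOn hei.integrableOn
      (measurableSet_cross (measurableSet_lowSet γ)) fun z _ => hk _ (f.mem_Icc' _ _)
  rw [integral_add (integrable_const k).integrableOn (hfi.const_mul c).integrableOn,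
    integral_const_mul, setIntegral_const, smul_eq_mul, volume_real_cross_lowSet hγ0 hγ1] at h1
  have h2 := mul_le_mul_of_nonneg_left hsqd hc
  have h3 : δ * (2 * (1 + 2 * c)) = γ * (1 - γ) * k - K := div_mul_cancel₀ _ (by positivity)
  linarith

end Graphon

/-! ### A minimizer that is not a block graphon -/

namespace Graphon

/-- The smaller block is the one to be split: `volume.real S ≤ 1/2` is what later distinguishes the
degree distributions. -/
lemma exists_side {γ : ℝ} (hγ0 : 0 < γ) (hγ1 : γ < 1) :
    ∃ S : Set I, MeasurableSet S ∧ (S = lowSet γ ∨ S = (lowSet γ)ᶜ) ∧ 0 < volume.real S ∧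
      volume.real S ≤ 1 / 2 ∧ ∀ l ∈ Set.Icc (0 : ℝ) 1,
        ∃ S₁ ⊆ S, MeasurableSet S₁ ∧ volume.real S₁ = l * volume.real S := by
  have hm := measurableSet_lowSet γ
  have hv := volume_real_lowSet hγ0.le hγ1.le
  have hvc := volume_real_compl hm
  rw [hv] at hvc
  rcases le_total γ (1 / 2) with h | h
  · refine ⟨lowSet γ, hm, Or.inl rfl, by rw [hv]; exact hγ0, by rw [hv]; exact h, ?_⟩
    intro l hl
    have hlγ : l * γ ≤ γ := mul_le_of_le_one_left hγ0.le hl.2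
    exact ⟨lowSet (l * γ), fun x hx => le_trans hx hlγ, measurableSet_lowSet _,
      by rw [hv, volume_real_lowSet (mul_nonneg hl.1 hγ0.le) (by linarith)]⟩
  · refine ⟨(lowSet γ)ᶜ, hm.compl, Or.inr rfl, by rw [hvc]; linarith, by rw [hvc]; linarith, ?_⟩
    intro l hl
    have h1 : 0 ≤ l * (1 - γ) := mul_nonneg hl.1 (by linarith)
    have h2 : l * (1 - γ) ≤ 1 - γ := mul_le_of_le_one_left (by linarith) hl.2
    refine ⟨lowSet (γ + l * (1 - γ)) \ lowSet γ, fun x hx => hx.2,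
      (measurableSet_lowSet _).diff hm, ?_⟩
    have hsub : lowSet γ ⊆ lowSet (γ + l * (1 - γ)) := fun x hx =>
      le_trans (show (x : ℝ) ≤ γ from hx) (by linarith)
    rw [measureReal_sdiff hsub hm, hv, hvc, volume_real_lowSet (by linarith) (by linarith)]
    ring

lemma setIntegral_of_two_values {S S₁ : Set I} (hS : MeasurableSet S) (hS₁ : MeasurableSet S₁)
    (hsub : S₁ ⊆ S) {F : I → ℝ} (hF : Integrable F) {b₁ b₂ : ℝ} (h1 : ∀ x ∈ S₁, F x = b₁)
    (h2 : ∀ x ∈ S \ S₁, F x = b₂) :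
    ∫ x in S, F x = volume.real S₁ * b₁ + (volume.real S - volume.real S₁) * b₂ := by
  rw [← measureReal_sdiff hsub hS₁]
  nth_rewrite 1 [← Set.union_sdiff_cancel hsub]
  rw [setIntegral_union Set.disjoint_sdiff_right (hS.diff hS₁) hF.integrableOn hF.integrableOn,
    setIntegral_congr_fun (g := fun _ => b₁) hS₁ h1,
    setIntegral_congr_fun (g := fun _ => b₂) (hS.diff hS₁) h2, setIntegral_const,
    setIntegral_const, smul_eq_mul, smul_eq_mul]

lemma integral_of_three_values {S S₁ : Set I} (hS : MeasurableSet S) (hS₁ : MeasurableSet S₁)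
    (hsub : S₁ ⊆ S) {F : I → ℝ} (hF : Integrable F) {b₁ b₂ b₃ : ℝ} (h1 : ∀ x ∈ S₁, F x = b₁)
    (h2 : ∀ x ∈ S \ S₁, F x = b₂) (h3 : ∀ x ∉ S, F x = b₃) :
    ∫ x, F x = volume.real S₁ * b₁ + (volume.real S - volume.real S₁) * b₂ +
      (1 - volume.real S) * b₃ := by
  rw [← integral_add_compl hS hF, setIntegral_of_two_values hS hS₁ hsub hF h1 h2,
    setIntegral_congr_fun (g := fun _ => b₃) hS.compl h3, setIntegral_const, smul_eq_mul,
    volume_real_compl hS]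

open Classical in
/-- The graphon supported on `S × Sᶜ ∪ Sᶜ × S` whose values only depend, through `a`, on the
coordinate in `S`. -/
noncomputable def star (S : Set I) (hS : MeasurableSet S) (a : I → ℝ) (ha : Measurable a)
    (hb : ∀ x, a x ∈ Set.Icc (0 : ℝ) 1) : Graphon where
  toFun x y := if x ∈ S ∧ y ∉ S then a x else if y ∈ S ∧ x ∉ S then a y else 0
  measurable' := by
    refine Measurable.ite (hS.prod hS.compl) (ha.comp measurable_fst) (Measurable.ite ?_
      (ha.comp measurable_snd) measurable_const)
    exact (measurable_snd hS).inter (measurable_fst hS).compl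
  mem_Icc' x y := by
    split_ifs
    · exact hb x
    · exact hb y
    · simp
  symm' x y := by
    by_cases hx : x ∈ S <;> by_cases hy : y ∈ S <;> simp [hx, hy]

section Star

variable {S : Set I} {hS : MeasurableSet S} {a : I → ℝ} {ha : Measurable a}
  {hb : ∀ x, a x ∈ Set.Icc (0 : ℝ) 1}

lemma star_of_mem {x y : I} (hx : x ∈ S) (hy : y ∉ S) : star S hS a ha hb x y = a x := by
  simp [star, hx, hy]

lemma star_of_notMem_cross {x y : I} (h : (x, y) ∉ cross S) : star S hS a ha hb x y = 0 := by
  simp only [mem_cross, not_or] at h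
  simp only [star]
  rw [if_neg h.1, if_neg fun h' => h.2 h'.symm]

lemma degree_star_of_mem {x : I} (hx : x ∈ S) :
    (star S hS a ha hb).degree x = (1 - volume.real S) * a x := by
  have h : (star S hS a ha hb) x = Sᶜ.indicator fun _ => a x := by
    ext y
    by_cases hy : y ∈ S <;> simp [star, hx, hy]
  rw [degree, h, integral_indicator hS.compl, setIntegral_const, smul_eq_mul,
    volume_real_compl hS]

lemma degree_star_of_notMem {x : I} (hx : x ∉ S) :
    (star S hS a ha hb).degree x = ∫ y in S, a y := by
  have h : (star S hS a ha hb) x = S.indicator a := by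
    ext y
    by_cases hy : y ∈ S <;> simp [star, hx, hy]
  rw [degree, h, integral_indicator hS]

end Star

lemma degree_of_mem_blockGraphons {γ : ℝ} {g : Graphon} (hg : g ∈ blockGraphons ![γ, 1 - γ]) :
    ∃ c₁ c₂, (∀ x ∈ lowSet γ, g.degree x = c₁) ∧ ∀ x ∉ lowSet γ, g.degree x = c₂ := by
  classical
  obtain ⟨P, -, -, hP⟩ := hg
  have key : ∀ i, ∀ x ∈ blockInterval ![γ, 1 - γ] i,
      g.degree x = ∫ y, if y ∈ lowSet γ then P i 0 else P i 1 := by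
    intro i x hx
    refine integral_congr_ae (ae_of_all _ fun y => ?_)
    dsimp only
    split_ifs with hy
    · exact hP i 0 x hx y (by rwa [blockInterval_zero])
    · exact hP i 1 x hx y (by rwa [blockInterval_one])
  exact ⟨_, _, fun x hx => key 0 x (by rwa [blockInterval_zero]),
    fun x hx => key 1 x (by rwa [blockInterval_one])⟩

/-- If the degrees are constant and distinct on two parts of positive measure of the smaller
block, the class is not the class of a block graphon. -/
lemma toClass_notMem_blockClasses {γ : ℝ} {S S₁ : Set I} (hS : MeasurableSet S)
    (hS₁ : MeasurableSet S₁) (hsub : S₁ ⊆ S) (hγS : S = lowSet γ ∨ S = (lowSet γ)ᶜ)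
    (h1 : 0 < volume.real S₁) (h2 : volume.real S₁ < volume.real S)
    (h3 : volume.real S ≤ 1 / 2) {f : Graphon} {v₁ v₂ v₃ : ℝ} (hv : v₁ ≠ v₂)
    (hf1 : ∀ x ∈ S₁, f.degree x = v₁) (hf2 : ∀ x ∈ S \ S₁, f.degree x = v₂)
    (hf3 : ∀ x ∉ S, f.degree x = v₃) : f.toClass ∉ blockClasses ![γ, 1 - γ] := by
  rintro ⟨g, hg, hd⟩
  rw [dist_toClass] at hd
  obtain ⟨c₁, c₂, hc1, hc2⟩ : ∃ c₁ c₂, (∀ x ∈ S, g.degree x = c₁) ∧ ∀ x ∉ S, g.degree x = c₂ := by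
    obtain ⟨c₁, c₂, hc1, hc2⟩ := degree_of_mem_blockGraphons hg
    rcases hγS with rfl | rfl
    · exact ⟨c₁, c₂, hc1, hc2⟩
    · exact ⟨c₂, c₁, hc2, fun x hx => hc1 x (Set.notMem_compl_iff.1 hx)⟩
  have key : ∀ Φ : ℝ → ℝ, LipschitzWith 1 Φ →
      volume.real S₁ * Φ v₁ + (volume.real S - volume.real S₁) * Φ v₂ +
        (1 - volume.real S) * Φ v₃ = volume.real S * Φ c₁ + (1 - volume.real S) * Φ c₂ := by
    intro Φ hΦ
    have e1 := integral_of_three_values hS hS₁ hsub (integrable_comp_degree hΦ.continuous f)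
      (fun x hx => by rw [hf1 x hx]) (fun x hx => by rw [hf2 x hx]) (fun x hx => by rw [hf3 x hx])
    have e2 := integral_of_three_values hS hS₁ hsub (integrable_comp_degree hΦ.continuous g)
      (fun x hx => by rw [hc1 x (hsub hx)]) (fun x hx => by rw [hc1 x hx.1])
      (fun x hx => by rw [hc2 x hx])
    rw [← e1, integral_comp_degree_congr hd hΦ, e2]
    ring
  have lip : ∀ c : ℝ, LipschitzWith 1 fun x : ℝ => |x - c| := fun c => by
    refine LipschitzWith.of_dist_le_mul fun x y => ?_
    rw [Real.dist_eq, Real.dist_eq, NNReal.coe_one, one_mul]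
    refine (abs_abs_sub_abs_le_abs_sub _ _).trans (le_of_eq ?_)
    congr 1
    ring
  have lipmin : LipschitzWith 1 fun x : ℝ => min |x - c₁| |x - c₂| := by
    simpa using (lip c₁).min (lip c₂)
  -- This test function vanishes exactly at `c₁` and `c₂`, so every degree value of `f` is one of
  -- the two.
  have k1 := key _ lipmin
  simp only [sub_self, abs_zero, abs_nonneg, min_eq_left, min_eq_right, mul_zero, add_zero] at k1
  have n : ∀ x : ℝ, 0 ≤ min |x - c₁| |x - c₂| := fun x => le_min (abs_nonneg _) (abs_nonneg _)
  have val : ∀ x : ℝ, min |x - c₁| |x - c₂| = 0 → x = c₁ ∨ x = c₂ := fun x hx => by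
    rcases min_choice |x - c₁| |x - c₂| with h | h <;> rw [h, abs_eq_zero, sub_eq_zero] at hx
    · exact Or.inl hx
    · exact Or.inr hx
  have p1 := mul_nonneg h1.le (n v₁)
  have p2 := mul_nonneg (sub_pos.2 h2).le (n v₂)
  have p3 := mul_nonneg (show 0 ≤ 1 - volume.real S by linarith) (n v₃)
  have z1 := val v₁ ((mul_eq_zero.1 (show volume.real S₁ * _ = 0 by linarith)).resolve_left h1.ne')
  have z2 := val v₂ ((mul_eq_zero.1
    (show (volume.real S - volume.real S₁) * _ = 0 by linarith)).resolve_left (sub_pos.2 h2).ne')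
  have z3 := val v₃ ((mul_eq_zero.1
    (show (1 - volume.real S) * _ = 0 by linarith)).resolve_left (by linarith))
  -- This test function measures the mass of degrees equal to `c₂`, which is `1 - |S|` for `g`. As
  -- `v₁ ≠ v₂`, exactly one of them is `c₂`. For `f` that mass is thus less than `|S| ≤ 1 - |S|` if
  -- `v₃ = c₁`, and more than `1 - |S|` if `v₃ = c₂`.
  have k2 := key _ (lip c₁)
  have hne : c₁ ≠ c₂ := by
    rintro rfl
    rw [or_self] at z1 z2
    exact hv (z1.trans z2.symm)
  have hw : 0 < |c₂ - c₁| := abs_pos.2 (sub_ne_zero.2 hne.symm)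
  rcases z1 with rfl | rfl <;> rcases z2 with rfl | rfl <;> rcases z3 with rfl | rfl <;>
    first
    | exact hv rfl
    | (simp only [sub_self, abs_zero, mul_zero, zero_add, add_zero] at k2; nlinarith)

/-- Off the convex minorant there is a minimizer that is not the class of a block graphon. -/
lemma exists_isMinimizer_notMem_blockClasses {p r γ : ℝ} (hp0 : 0 < p) (hp1 : p < 1)
    (hp : p ∈ Set.Icc (0 : ℝ) 1) (hpr : p ≤ r) (hr1 : r ≤ 1) (hr : r ∈ Set.Icc (0 : ℝ) 1)
    (hγ0 : 0 < γ) (hγ1 : γ < 1)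
    (h : ¬ OnConvexMinorant (Set.Icc 0 1) (fun x => relEntropy p (√x)) (r ^ 2) (relEntropy p r)) :
    ∃ F, (bipartite γ p hp).IsMinimizer GraphonSpace.opNorm (bipartite γ r hr).opNorm F ∧
      F ∉ blockClasses ![γ, 1 - γ] := by
  classical
  obtain ⟨k, c, u₁, u₂, hc, hu₁, hu₁r, hru₂, hu₂, hk, e₁, e₂⟩ :=
    exists_touching_parabola hp0 hp1 hpr hr1 h
  obtain ⟨S, hS, hSγ, hS0, hS2, hsplit⟩ := exists_side hγ0 hγ1
  have hd : 0 < u₂ ^ 2 - u₁ ^ 2 := by nlinarith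
  -- The weight for which `l u₁² + (1 - l) u₂² = r²`. The same weight averages the parabola, hence
  -- the entropy at the contact points, to exactly `k`.
  set l := (u₂ ^ 2 - r ^ 2) / (u₂ ^ 2 - u₁ ^ 2) with hl
  have hl0 : 0 < l := div_pos (by nlinarith [hr.1]) hd
  have hl1 : l < 1 := by rw [hl, div_lt_one hd]; nlinarith
  have hle : l * (u₂ ^ 2 - u₁ ^ 2) = u₂ ^ 2 - r ^ 2 := div_mul_cancel₀ _ hd.ne'
  obtain ⟨S₁, hsub, hS₁, hvS₁⟩ := hsplit l ⟨hl0.le, hl1.le⟩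
  set σS := volume.real S with hσ
  have hcross : cross S = cross (lowSet γ) := by
    rcases hSγ with rfl | rfl
    · rfl
    · exact cross_compl _
  have hvol : σS * (1 - σS) = γ * (1 - γ) := by
    have hv := volume_real_lowSet hγ0.le hγ1.le
    rcases hSγ with rfl | rfl
    · rw [hσ, hv]
    · rw [hσ, volume_real_compl (measurableSet_lowSet γ), hv]
      ring
  set a : I → ℝ := fun x => if x ∈ S₁ then u₁ else u₂ with ha
  have ham : Measurable a := Measurable.ite hS₁ measurable_const measurable_const
  have hab : ∀ x, a x ∈ Set.Icc (0 : ℝ) 1 := fun x => by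
    simp only [ha]
    split_ifs
    · exact ⟨hu₁, by linarith⟩
    · exact ⟨by linarith, hu₂⟩
  have ha1 : ∀ x ∈ S₁, a x = u₁ := fun x hx => if_pos hx
  have ha2 : ∀ x ∈ S \ S₁, a x = u₂ := fun x hx => if_neg hx.2
  have hai : ∀ φ : ℝ → ℝ, Continuous φ → ∫ x in S, φ (a x) =
      l * σS * φ u₁ + (σS - l * σS) * φ u₂ := fun φ hφ => by
    have hint : Integrable fun x => φ (a x) := by
      obtain ⟨C, hC⟩ := isCompact_Icc.exists_bound_of_continuousOn (s := Set.Icc (0 : ℝ) 1)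
        hφ.continuousOn
      exact Integrable.of_bound (hφ.measurable.comp ham).aestronglyMeasurable C
        (ae_of_all _ fun x => hC _ (hab x))
    rw [setIntegral_of_two_values hS hS₁ hsub hint (fun x hx => by rw [ha1 x hx])
      (fun x hx => by rw [ha2 x hx]), hvS₁]
  set f := star S hS a ham hab with hf
  have hf0 : ∀ x y, (x, y) ∉ cross (lowSet γ) → f x y = 0 := fun x y hxy =>
    star_of_notMem_cross (by rwa [hcross])
  have hfa : ∀ x ∈ S, ∀ y ∉ S, f x y = a x := fun x hx y hy => star_of_mem hx hy
  have hop : (bipartite γ r hr).opNorm ≤ f.opNorm := by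
    rw [opNorm_bipartite hγ0 hγ1]
    refine le_trans (le_of_eq ?_) (sqrt_le_opNorm_of_fst hS
      (by rw [volume_real_compl hS]; linarith) hfa)
    rw [hai (fun u => u ^ 2) (by fun_prop), volume_real_compl hS, ← hσ, ← hvol]
    congr 1
    linear_combination σS * (1 - σS) * hle
  have hent : (bipartite γ p hp).entropy f ≤ ENNReal.ofReal (γ * (1 - γ) * k) := by
    rw [entropy_bipartite_eq hp0 hp1 hp hf0, ← hcross,
      setIntegral_cross_of_fst hS hfa (continuous_relEntropy hp0 hp1),
      hai _ (continuous_relEntropy hp0 hp1), volume_real_compl hS, ← hσ, e₁, e₂, ← hvol]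
    refine ENNReal.ofReal_le_ofReal (le_of_eq ?_)
    linear_combination (-(c * σS * (1 - σS))) * hle
  refine ⟨f.toClass, ⟨hop, fun G hG => ?_⟩, ?_⟩
  · exact ((rate_toClass_le (mem_agreeing_bipartite hp0 hp1 hp hf0)).trans hent).trans
      (ofReal_le_rate hp0 hp1 hp hr hγ0 hγ1 hc hk hG)
  · refine toClass_notMem_blockClasses (v₁ := (1 - σS) * u₁) (v₂ := (1 - σS) * u₂)
      hS hS₁ hsub hSγ (by rw [hvS₁]; positivity) (by rw [hvS₁]; nlinarith) hS2 ?_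
      (fun x hx => by rw [hf, degree_star_of_mem (hsub hx), ha1 x hx])
      (fun x hx => by rw [hf, degree_star_of_mem hx.1, ha2 x hx])
      (fun x hx => degree_star_of_notMem hx)
    intro he
    have := mul_left_cancel₀ (by linarith) he
    linarith

end Graphon

theorem theorem1p8 (p r γ : ℝ) (hp0 : 0 < p) (hp1 : p < 1) (hpr : p ≤ r) (hr1 : r ≤ 1)
    (hγ0 : 0 < γ) (hγ1 : γ < 1) (W₀ fr : Graphon) (t : ℝ)
    (hW₀ : W₀ = Graphon.bipartite γ p ⟨hp0.le, hp1.le⟩)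
    (hfr : fr = Graphon.bipartite γ r ⟨hp0.le.trans hpr, hr1⟩)
    (ht : t = fr.opNorm) :
    t ≤ W₀.tMax GraphonSpace.opNorm ∧
    (OnConvexMinorant (Set.Icc 0 1) (fun x => relEntropy p (√x)) (r ^ 2) (relEntropy p r) →
      Graphon.InSymmetricRegime ![γ, 1 - γ] W₀ GraphonSpace.opNorm t ∧
      ∀ F : GraphonSpace, W₀.IsMinimizer GraphonSpace.opNorm t F ↔ F = fr.toClass) ∧
    (¬ OnConvexMinorant (Set.Icc 0 1) (fun x => relEntropy p (√x)) (r ^ 2) (relEntropy p r) →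
      ¬ Graphon.InSymmetricRegime ![γ, 1 - γ] W₀ GraphonSpace.opNorm t) := by
  have hp : p ∈ Set.Icc (0 : ℝ) 1 := ⟨hp0.le, hp1.le⟩
  have hr : r ∈ Set.Icc (0 : ℝ) 1 := ⟨hp0.le.trans hpr, hr1⟩
  have hagree : fr ∈ W₀.agreeing := by
    subst hW₀ hfr
    exact Graphon.mem_agreeing_bipartite hp0 hp1 hp fun x y h =>
      Graphon.bipartite_of_notMem_cross hr h
  refine ⟨by rw [ht]; exact Graphon.opNorm_le_tMax hagree, fun h => ?_, fun h hsym => ?_⟩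
  · have hent : W₀.entropy fr ≤ ENNReal.ofReal (γ * (1 - γ) * relEntropy p r) := by
      subst hW₀ hfr
      rw [Graphon.entropy_bipartite_eq hp0 hp1 hp fun x y h =>
        Graphon.bipartite_of_notMem_cross hr h]
      refine ENNReal.ofReal_le_ofReal (le_of_eq ?_)
      rw [setIntegral_congr_fun (g := fun _ => relEntropy p r)
        (Graphon.measurableSet_cross (Graphon.measurableSet_lowSet γ)) fun z hz => by
          rw [Graphon.bipartite_of_mem_cross hr hz], setIntegral_const, smul_eq_mul,
        Graphon.volume_real_cross_lowSet hγ0 hγ1]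
      ring
    have hrate := (Graphon.rate_toClass_le hagree).trans hent
    -- Anything admissible that does at least as well as `f_r^γ` equals it. This yields both
    -- uniqueness and minimality, with no compactness argument for existence.
    have huniq : ∀ F : GraphonSpace, t ≤ F.opNorm → W₀.rate F ≤ W₀.rate fr.toClass →
        F = fr.toClass := fun F hF hle => by
      subst hW₀ hfr ht
      exact Graphon.toClass_eq_of_rate_le hp0 hp1 hp hpr hr1 hr hγ0 hγ1 h (hle.trans hrate) hF
    have hopt : t ≤ GraphonSpace.opNorm fr.toClass := ht.le
    have hiff : ∀ F : GraphonSpace, W₀.IsMinimizer GraphonSpace.opNorm t F ↔ F = fr.toClass := by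
      refine fun F => ⟨fun hF => huniq F hF.1 (hF.2 _ hopt), ?_⟩
      rintro rfl
      refine ⟨hopt, fun G hG => ?_⟩
      by_contra! hlt
      rw [huniq G hG hlt.le] at hlt
      exact lt_irrefl _ hlt
    refine ⟨fun F hF => ⟨fr, ?_, by rw [(hiff F).1 hF, dist_self]⟩, hiff⟩
    rw [hfr]
    exact Graphon.bipartite_mem_blockGraphons hr
  · subst hW₀ hfr ht
    obtain ⟨F, hF, hnot⟩ := Graphon.exists_isMinimizer_notMem_blockClasses hp0 hp1 hp hpr hr1 hr
      hγ0 hγ1 h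
    exact hnot (hsym F hF)
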